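/- Consider the following discrete-time feedback loop. Let $N\in\mathbb N$ and let $\Pi\subseteq\mathbb R$ be the set of admissible signals. Each agent $i\in\{1,\dots,N\}$ has a closed nonempty state space $\mathbb X_i\subseteq\mathbb R^{n_i}$ (often $\mathbb R^{n_i}$, with the Euclidean norm), finitely many transition maps $\mathcal W_{ij}:\mathbb X_i\to\mathbb X_i$, $1\le j\le w_i$, and finitely many output maps $\mathcal H_{i\ell}:\mathbb X_i\to\mathbb R$, $1\le \ell\le h_i$. At time $k$, given the current states and the broadcast signal $\pi(k)\in\Pi$, all agents choose independently $x_i(k+1)=\mathcal W_{ij}(x_i(k))$ with probability $p_{ij}(\pi(k))$ and $y_i(k)=\mathcal H_{i\ell}(x_i(k))$ with probability $p'_{i\ell}(\pi(k))$ (the two choices of an agent being independent as well), where $p_{ij},p'_{i\ell}:\Pi\to[0,1]$ and $\sum_j p_{ij}(\pi)=\sum_\ell p'_{i\ell}(\pi)=1$ for all $\pi\in\Pi$. The aggregate output $y(k)=\sum_i y_i(k)$ enters a linear filter $$\mathcal F:\quad x_f(k+1)=A_fx_f(k)+B_fy(k),\qquad \hat y(k)=C_fx_f(k),$$ and, with a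 constant reference $r\in\mathbb R$ and the error $e(k)=r-\hat y(k)$, the signal is produced by a linear controller $$\mathcal C:\quad x_c(k+1)=A_cx_c(k)+B_ce(k),\qquad \pi(k)=C_cx_c(k)+D_ce(k).$$ The states of $\mathcal F$ and $\mathcal C$ lie in closed nonempty sets $\mathbb X_F\subseteq\mathbb R^{n_f}$ and $\mathbb X_C\subseteq\mathbb R^{n_c}$. Filter and controller are called compatible with the feedback structure if these sets are preserved by the loop and $\pi(k)\in\Pi$ for all states of the loop (this is automatic for $\mathbb X_F=\mathbb R^{n_f}$, $\mathbb X_C=\mathbb R^{n_c}$, $\Pi=\mathbb R$); they are called stable if $A_f$ and $A_c$ are Schur matrices, i.e. all their eigenvalues have modulus less than $1$. The loop is then a Markov chain (an iterated function system) on $\mathbb X=\prod_i\mathbb X_i\times\mathbb X_F\times\mathbb X_C$; write $P$ for its transition operator. A function $p:\Pi\to\mathbb R$ is Dini continuous if its modulus of continuity $\varphi(t)=\sup\{|p(a)-p(b)|: a,b\in\Pi,\ |a-b|\le t\}$ satisfies $\int_0^{\varepsilon}\varphi(t)\,t^{-1}\,dt<\infty$ for some $\varepsilon>0$. An invariant probability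 measure $\mu=\mu P$ is attractive if $\nu P^k\to\mu$ in distribution for every probability measure $\nu$ on $\mathbb X$, and ergodic if every measurable set $S$ with $P(x,S)=1$ for $\mu$-almost every $x\in S$ has $\mu(S)\in\{0,1\}$. The chain is uniquely ergodic if it has an attractive, unique, ergodic invariant probability measure $\mu$ such that for every continuous $g:\mathbb X\to\mathbb R$ the expectation $\mathbb E_\mu(g)$ is finite and for every deterministic initial condition $x_0\in\mathbb X$ $$\lim_{k\to\infty}\frac1{k+1}\sum_{\nu=0}^{k}g(X(\nu))=\mathbb E_\mu(g)\qquad \mathbb P_{x_0}\text{-almost surely.}$$ **Theorem.** Assume that the maps $\mathcal W_{ij}$ and $\mathcal H_{i\ell}$ are globally Lipschitz continuous with constants $l_{ij}$ and $l'_{i\ell}$, that $l_{ij}<1$ for all $i,j$, that all $p_{ij}$ and $p'_{i\ell}$ are Dini continuous, and that there are $\delta,\delta'>0$ with $p_{ij}(\pi)\ge\delta$ and $p'_{i\ell}(\pi)\ge\delta'$ for all $i,j,\ell$ and all $\pi\in\Pi$. Then, for every stable linear controller $\mathcal C$ and every stable linear filter $\mathcal F$ compatible with the feedback structure, the feedback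 loop has a unique invariant probability measure, and this measure is attractive. In particular, the loop is uniquely ergodic. -/

import Mathlib

open MeasureTheory ProbabilityTheory Filter Topology
open scoped NNReal ENNReal

/-! ### Dini continuity -/

/-- The modulus of (uniform) continuity `t ↦ sup {|p a - p b| : dist a b ≤ t}` of a real function,
with values in `[0, ∞]`. -/
noncomputable def continuityModulus {α : Type*} [PseudoMetricSpace α] (p : α → ℝ) (t : ℝ) : ℝ≥0∞ :=
  ⨆ (a : α) (b : α) (_ : dist a b ≤ t), edist (p a) (p b)

/-- Dini's condition: the modulus of continuity `φ` satisfies `∫₀^ε φ(t) / t dt < ∞`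
for some `ε > 0`. -/
def DiniContinuous {α : Type*} [PseudoMetricSpace α] (p : α → ℝ) : Prop :=
  ∃ ε : ℝ, 0 < ε ∧ ∫⁻ t in Set.Ioc 0 ε, continuityModulus p t / ENNReal.ofReal t < ∞

/-! ### Markov chains with transition kernel `P` on a state space `S` -/

namespace MarkovChain

variable {S : Type*} [MeasurableSpace S]

/-- One step `ν ↦ ν P` of the chain, where `(ν P)(G) = ∫ P(x, G) ν(dx)`. -/
noncomputable def step (P : Kernel S S) [IsMarkovKernel P] (ν : ProbabilityMeasure S) :
    ProbabilityMeasure S :=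
  ⟨(ν : Measure S).bind P, inferInstance⟩

/-- The law on the path space `S^∞` of the chain started at the deterministic point `x₀`. -/
noncomputable def pathLaw (P : Kernel S S) [IsMarkovKernel P] (x₀ : S) : Measure (ℕ → S) :=
  Kernel.trajMeasure (X := fun _ => S) (Measure.dirac x₀)
    (fun k => P.comap (fun h : (i : Finset.Iic k) → S => h ⟨k, Finset.mem_Iic.2 le_rfl⟩)
      (measurable_pi_apply _))

/-- `μ` is an invariant probability measure: `μ P = μ`. -/
def IsInvariant (P : Kernel S S) (μ : ProbabilityMeasure S) : Prop :=
  Kernel.Invariant P (μ : Measure S)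

/-- `μ` is ergodic: it is invariant, and every measurable set `A` with `P(x, A) = 1` for
`μ`-almost every `x ∈ A` has `μ`-measure `0` or `1`. -/
def IsErgodic (P : Kernel S S) (μ : ProbabilityMeasure S) : Prop :=
  IsInvariant P μ ∧
    ∀ A : Set S, MeasurableSet A → (∀ᵐ x ∂(μ : Measure S), x ∈ A → P x A = 1) →
      (μ : Measure S) A = 0 ∨ (μ : Measure S) A = 1

variable [TopologicalSpace S] [OpensMeasurableSpace S]

/-- `μ` is attractive: from every initial distribution, the law at time `k` converges to `μ` in
distribution (the topology of `ProbabilityMeasure S` is that of weak convergence). -/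
def IsAttractive (P : Kernel S S) [IsMarkovKernel P] (μ : ProbabilityMeasure S) : Prop :=
  ∀ ν : ProbabilityMeasure S, Tendsto (fun k : ℕ => (step P)^[k] ν) atTop (𝓝 μ)

/-- For every continuous real function `g` and every deterministic initial condition `x₀`, the time
averages of `g` along the chain started at `x₀` converge almost surely to the (finite) expectation
of `g` under `μ`. -/
def TimeAveragesConverge (P : Kernel S S) [IsMarkovKernel P] (μ : ProbabilityMeasure S) : Prop :=
  ∀ g : S → ℝ, Continuous g →
    Integrable g (μ : Measure S) ∧
      ∀ x₀ : S, ∀ᵐ X ∂(pathLaw P x₀),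
        Tendsto (fun k : ℕ => (∑ s ∈ Finset.range (k + 1), g (X s)) / ((k : ℝ) + 1)) atTop
          (𝓝 (∫ x, g x ∂(μ : Measure S)))

/-- The chain has a unique invariant probability measure, and that measure is attractive. -/
def HasUniqueAttractiveInvariantMeasure (P : Kernel S S) [IsMarkovKernel P] : Prop :=
  ∃ μ : ProbabilityMeasure S, IsInvariant P μ ∧ IsAttractive P μ ∧
    ∀ ν : ProbabilityMeasure S, IsInvariant P ν → ν = μ

/-- Unique ergodicity: there is an attractive, unique, ergodic invariant probability measure, for
which the time averages converge from all deterministic initial conditions. -/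
def UniquelyErgodic (P : Kernel S S) [IsMarkovKernel P] : Prop :=
  ∃ μ : ProbabilityMeasure S, IsInvariant P μ ∧ IsAttractive P μ ∧
    (∀ ν : ProbabilityMeasure S, IsInvariant P ν → ν = μ) ∧
    IsErgodic P μ ∧ TimeAveragesConverge P μ

end MarkovChain

/-! ### Iterated function systems with place-dependent probabilities -/

/-- A finite family of maps `f m : S → S`; at the state `x` the map `f m` is chosen with
probability `q m x`. -/
structure IFS (S : Type*) [MeasurableSpace S] (M : Type*) [Fintype M] where
  f : M → S → S
  q : M → S → ℝ
  measurable_f : ∀ m, Measurable (f m)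
  measurable_q : ∀ m, Measurable (q m)
  q_nonneg : ∀ m x, 0 ≤ q m x
  q_sum : ∀ x, ∑ m, q m x = 1

namespace IFS

variable {S : Type*} [MeasurableSpace S] {M : Type*} [Fintype M]

/-- The transition kernel `P(x, ·) = ∑ₘ q m x • δ_{f m x}`. -/
noncomputable def kernel (I : IFS S M) : Kernel S S where
  toFun x := ∑ m, ENNReal.ofReal (I.q m x) • Measure.dirac (I.f m x)
  measurable' := by
    refine Measure.measurable_of_measurable_coe _ fun A hA => ?_
    simp only [Measure.coe_finsetSum, Finset.sum_apply, Measure.smul_apply, smul_eq_mul]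
    refine Finset.measurable_sum _ fun m _ => ?_
    refine (I.measurable_q m).ennreal_ofReal.mul ?_
    exact (Measure.measurable_coe hA).comp (Measure.measurable_dirac.comp (I.measurable_f m))

instance (I : IFS S M) : IsMarkovKernel I.kernel where
  isProbabilityMeasure x := ⟨by
    change (∑ m, ENNReal.ofReal (I.q m x) • Measure.dirac (I.f m x)) Set.univ = 1
    simp only [Measure.coe_finsetSum, Finset.sum_apply, Measure.smul_apply, smul_eq_mul,
      measure_univ, mul_one]
    rw [← ENNReal.ofReal_sum_of_nonneg (fun m _ => I.q_nonneg m x), I.q_sum, ENNReal.ofReal_one]⟩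

end IFS

/-! ### The blocks of the feedback system -/

/-- A population of `N` agents that respond to signals in `Sig ⊆ ℝ`. Agent `i` has a private state
in the closed nonempty set `X i ⊆ ℝ^(n i)`, finitely many transition maps `W i j` and output maps
`H i l`, which it chooses with probabilities `p i j π` and `p' i l π` when the signal is `π`. -/
structure Population (N : ℕ) (Sig : Set ℝ) where
  n : Fin N → ℕ
  X : (i : Fin N) → Set (EuclideanSpace ℝ (Fin (n i)))
  isClosed_X : ∀ i, IsClosed (X i)
  nonempty_X : ∀ i, (X i).Nonempty
  w : Fin N → ℕ
  h : Fin N → ℕ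
  W : (i : Fin N) → Fin (w i) → X i → X i
  H : (i : Fin N) → Fin (h i) → X i → ℝ
  p : (i : Fin N) → Fin (w i) → Sig → ℝ
  p' : (i : Fin N) → Fin (h i) → Sig → ℝ
  measurable_W : ∀ i j, Measurable (W i j)
  measurable_H : ∀ i l, Measurable (H i l)
  measurable_p : ∀ i j, Measurable (p i j)
  measurable_p' : ∀ i l, Measurable (p' i l)
  p_nonneg : ∀ i j π, 0 ≤ p i j π
  p'_nonneg : ∀ i l π, 0 ≤ p' i l π
  p_sum : ∀ i π, ∑ j, p i j π = 1
  p'_sum : ∀ i π, ∑ l, p' i l π = 1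

/-- A real square matrix is Schur: all its complex eigenvalues have modulus less than `1`. -/
def IsSchur {n : ℕ} (A : Matrix (Fin n) (Fin n) ℝ) : Prop :=
  ∀ z ∈ spectrum ℂ (A.map (algebraMap ℝ ℂ)), ‖z‖ < 1

/-- A linear filter `x⁺ = A x + B y`, `ŷ = C x`, with states in the closed nonempty set `X`. -/
structure LinearFilter where
  n : ℕ
  X : Set (Fin n → ℝ)
  isClosed_X : IsClosed X
  nonempty_X : X.Nonempty
  A : Matrix (Fin n) (Fin n) ℝ
  B : Fin n → ℝ
  C : Fin n → ℝ

/-- The next state of the filter. -/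
def LinearFilter.next (F : LinearFilter) (x : Fin F.n → ℝ) (y : ℝ) : Fin F.n → ℝ :=
  F.A.mulVec x + y • F.B

/-- The output of the filter. -/
def LinearFilter.out (F : LinearFilter) (x : Fin F.n → ℝ) : ℝ :=
  F.C ⬝ᵥ x

/-- A linear controller `x⁺ = A x + B e`, `π = C x + D e`, with states in the closed nonempty
set `X`. -/
structure LinearController where
  n : ℕ
  X : Set (Fin n → ℝ)
  isClosed_X : IsClosed X
  nonempty_X : X.Nonempty
  A : Matrix (Fin n) (Fin n) ℝ
  B : Fin n → ℝ
  C : Fin n → ℝ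
  D : ℝ

/-- The next state of the controller. -/
def LinearController.next (K : LinearController) (x : Fin K.n → ℝ) (e : ℝ) : Fin K.n → ℝ :=
  K.A.mulVec x + e • K.B

/-- The signal that the controller broadcasts. -/
def LinearController.out (K : LinearController) (x : Fin K.n → ℝ) (e : ℝ) : ℝ :=
  K.C ⬝ᵥ x + K.D * e

/-! ### The feedback loop -/

namespace Population

variable {N : ℕ} {Sig : Set ℝ}

/-- The blocks fit together in the loop with reference value `r`: filter and controller stay in
their state spaces, and the broadcast signal is admissible. If all the state spaces of filter and
controller are the whole space and `Sig = ℝ`, this always holds. -/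
structure Compatible (S : Population N Sig) (K : LinearController) (F : LinearFilter) (r : ℝ) :
    Prop where
  filter_mem : ∀ (x : ∀ i, S.X i) (l : ∀ i, Fin (S.h i)), ∀ xf ∈ F.X,
    F.next xf (∑ i, S.H i (l i) (x i)) ∈ F.X
  controller_mem : ∀ xf ∈ F.X, ∀ xc ∈ K.X, K.next xc (r - F.out xf) ∈ K.X
  signal_mem : ∀ xf ∈ F.X, ∀ xc ∈ K.X, K.out xc (r - F.out xf) ∈ Sig

/-- The state space of the loop: the product of the state spaces of agents, filter and
controller. -/
abbrev LoopState (S : Population N Sig) (K : LinearController) (F : LinearFilter) : Type :=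
  (∀ i, S.X i) × F.X × K.X

/-- The index set of the maps of the loop: a choice of a transition map and of an output map for
each agent. -/
abbrev LoopIndex (S : Population N Sig) : Type :=
  (∀ i, Fin (S.w i)) × (∀ i, Fin (S.h i))

variable {S : Population N Sig} {K : LinearController} {F : LinearFilter} {r : ℝ}

/-- The signal that is broadcast when the loop is in the given state; the error is `e = r - ŷ`. -/
def signal (hc : S.Compatible K F r) (ξ : S.LoopState K F) : Sig :=
  ⟨K.out ξ.2.2 (r - F.out ξ.2.1), hc.signal_mem _ ξ.2.1.2 _ ξ.2.2.2⟩

/-- The map of the loop that belongs to a choice of transition and output maps. -/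
def loopMap (hc : S.Compatible K F r) (m : S.LoopIndex) (ξ : S.LoopState K F) :
    S.LoopState K F :=
  (fun i => S.W i (m.1 i) (ξ.1 i),
    ⟨F.next ξ.2.1 (∑ i, S.H i (m.2 i) (ξ.1 i)), hc.filter_mem _ _ _ ξ.2.1.2⟩,
    ⟨K.next ξ.2.2 (r - F.out ξ.2.1), hc.controller_mem _ ξ.2.1.2 _ ξ.2.2.2⟩)

theorem measurable_filterOut (F : LinearFilter) : Measurable F.out := by
  unfold LinearFilter.out dotProduct
  fun_prop

theorem measurable_signal (hc : S.Compatible K F r) : Measurable (signal hc) := by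
  refine Measurable.subtype_mk ?_
  have h1 : Measurable fun ξ : S.LoopState K F => F.out ξ.2.1 :=
    (measurable_filterOut F).comp (by fun_prop)
  have h3 : ∀ b, Measurable fun ξ : S.LoopState K F => (ξ.2.2 : Fin K.n → ℝ) b := fun b =>
    (measurable_pi_apply b).comp (by fun_prop)
  unfold LinearController.out dotProduct
  fun_prop

theorem measurable_loopMap (hc : S.Compatible K F r) (m : S.LoopIndex) :
    Measurable (loopMap hc m) := by
  have h1 : Measurable fun ξ : S.LoopState K F => F.out ξ.2.1 :=
    (measurable_filterOut F).comp (by fun_prop)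
  have h2 : ∀ i, Measurable fun ξ : S.LoopState K F => S.H i (m.2 i) (ξ.1 i) := fun i =>
    (S.measurable_H i (m.2 i)).comp (by fun_prop)
  have h3 : ∀ b, Measurable fun ξ : S.LoopState K F => (ξ.2.2 : Fin K.n → ℝ) b := fun b =>
    (measurable_pi_apply b).comp (by fun_prop)
  have h4 : ∀ b, Measurable fun ξ : S.LoopState K F => (ξ.2.1 : Fin F.n → ℝ) b := fun b =>
    (measurable_pi_apply b).comp (by fun_prop)
  refine Measurable.prodMk ?_ (Measurable.prodMk (Measurable.subtype_mk ?_)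
    (Measurable.subtype_mk ?_))
  · exact measurable_pi_lambda _ fun i => (S.measurable_W i (m.1 i)).comp (by fun_prop)
  · refine measurable_pi_lambda _ fun a => ?_
    simp only [LinearFilter.next, Matrix.mulVec, dotProduct, Pi.add_apply, Pi.smul_apply,
      smul_eq_mul]
    fun_prop
  · refine measurable_pi_lambda _ fun a => ?_
    simp only [LinearController.next, Matrix.mulVec, dotProduct, Pi.add_apply, Pi.smul_apply,
      smul_eq_mul]
    fun_prop

/-- The feedback loop as an iterated function system: given the current state, all agents choose
their transition maps and output maps independently, according to the current signal. -/
noncomputable def loopIFS (hc : S.Compatible K F r) : IFS (S.LoopState K F) S.LoopIndex where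
  f := loopMap hc
  q m ξ := (∏ i, S.p i (m.1 i) (signal hc ξ)) * ∏ i, S.p' i (m.2 i) (signal hc ξ)
  measurable_f := measurable_loopMap hc
  measurable_q m :=
    (Finset.measurable_prod _ fun i _ => (S.measurable_p i _).comp (measurable_signal hc)).mul
      (Finset.measurable_prod _ fun i _ => (S.measurable_p' i _).comp (measurable_signal hc))
  q_nonneg m ξ := mul_nonneg (Finset.prod_nonneg fun i _ => S.p_nonneg i _ _)
    (Finset.prod_nonneg fun i _ => S.p'_nonneg i _ _)
  q_sum ξ := by
    rw [Fintype.sum_prod_type]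
    simp only [← Finset.mul_sum]
    rw [← Finset.sum_mul,
      ← Fintype.prod_sum (fun i (j : Fin (S.w i)) => S.p i j (signal hc ξ)),
      ← Fintype.prod_sum (fun i (j : Fin (S.h i)) => S.p' i j (signal hc ξ))]
    simp [S.p_sum, S.p'_sum]

end Population

/-! ### Dini continuity along geometric scales -/

/-! The feedback acts only through the probabilities. Once the maps are chosen, the agents move on
their own, their outputs drive the filter, and the filter drives the controller. Each map of the
loop is therefore a cascade of contractions. A weighted sum of the agents' distances and of adapted
norms for filter and controller (`IsSchur.exists_seminorm`) shrinks by a common factor ρ < 1 under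
all of them (`Population.exists_contracting`). The signal is a Lipschitz function of the state, so
the probabilities inherit a modulus that Dini's condition makes summable along D ρ^n
(`DiniContinuous.summable_continuityModulus`).

For such a system, run two copies from points of a compact forward invariant set at gauge distance
at most D ρ^n ("level n"), and let them choose the same map with the largest possible probability.
With probability at least 1 - ψ n they agree and reach level n + 1. Otherwise only the size of the
set bounds their distance, which is level 0. Hence `renewal` dominates the oscillation of the
iterates T^k g of a continuous g. As ψ is summable and bounded by 1 - d < 1, the chance of never
falling back is positive; the level escapes to infinity and the oscillation vanishes
(`tendsto_renewal`, `IFS.Contracting.exists_oscillation_bound`).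

Compactness then provides a measure μ with T^k g → ∫ g dμ (`IFS.Contracting.exists_limit`).
Attractiveness follows by dominated convergence, and uniqueness from attractiveness. Ergodicity
holds because conditioning μ on an absorbing set gives an invariant measure again. For time
averages, g may be replaced by T g up to a martingale that is negligible after division by time
(`MarkovChain.ae_tendsto_noise_div`), hence by T^k g, which is nearly constant on a compact set
containing the path (`IFS.Contracting.ae_tendsto_average`). Unbounded g are harmless, since μ and
each path live on compact sets. -/

theorem continuityModulus_mono {α : Type*} [PseudoMetricSpace α] (p : α → ℝ) :
    Monotone (continuityModulus p) := fun _ _ hst =>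
  iSup_mono fun _ => iSup_mono fun _ => iSup_mono' fun h => ⟨h.trans hst, le_rfl⟩

theorem continuityModulus_le_one {α : Type*} [PseudoMetricSpace α] {p : α → ℝ}
    (hp : ∀ a b, |p a - p b| ≤ 1) (t : ℝ) : continuityModulus p t ≤ 1 := by
  refine iSup_le fun a => iSup_le fun b => iSup_le fun _ => ?_
  rw [edist_dist, Real.dist_eq]
  exact ENNReal.ofReal_le_one.2 (hp a b)

/-- The oscillation bound keeps the modulus finite; otherwise `toReal` could send ∞ to 0. -/
theorem abs_sub_le_continuityModulus {α : Type*} [PseudoMetricSpace α] {p : α → ℝ}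
    (hp : ∀ a b, |p a - p b| ≤ 1) {a b : α} {t : ℝ} (h : dist a b ≤ t) :
    |p a - p b| ≤ (continuityModulus p t).toReal := by
  have h1 : edist (p a) (p b) ≤ continuityModulus p t :=
    le_iSup_of_le a (le_iSup_of_le b (le_iSup_of_le h le_rfl))
  have h2 := ENNReal.toReal_mono
    ((continuityModulus_le_one hp t).trans_lt ENNReal.one_lt_top).ne h1
  rwa [edist_dist, ENNReal.toReal_ofReal dist_nonneg, Real.dist_eq] at h2

/-- With φ the modulus, on (c ρ^(n+1), c ρ^n] the integrand φ(t)/t is at least φ(c ρ^(n+1)) / (c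
ρ^n), and the interval has length (1 - ρ) c ρ^n. These disjoint intervals thus contribute at least
(1 - ρ) φ(c ρ^(n+1)) each to a finite integral. -/
theorem DiniContinuous.summable_continuityModulus {α : Type*} [PseudoMetricSpace α] {p : α → ℝ}
    (h : DiniContinuous p) {c ρ : ℝ} (hc : 0 < c) (h0 : 0 < ρ)
    (h1 : ρ < 1) : Summable fun n : ℕ => (continuityModulus p (c * ρ ^ n)).toReal := by
  obtain ⟨ε, hε, hint⟩ := h
  have hlim : Tendsto (fun n : ℕ => c * ρ ^ n) atTop (𝓝 0) := by
    simpa using (tendsto_pow_atTop_nhds_zero_of_lt_one h0.le h1).const_mul c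
  -- From index `n0` on, the intervals lie in (0, ε]; the finitely many earlier terms do not affect
  -- summability.
  obtain ⟨n0, hn0⟩ := (hlim.eventually (gt_mem_nhds hε)).exists
  have hpos : ∀ n : ℕ, 0 < c * ρ ^ n := fun n => by positivity
  have hanti : Antitone fun n : ℕ => c * ρ ^ (n0 + n) := by
    refine antitone_nat_of_succ_le fun n => ?_
    rw [← add_assoc, pow_succ, ← mul_assoc]
    exact mul_le_of_le_one_right (hpos _).le h1.le
  let s : ℕ → Set ℝ := fun n => Set.Ioc (c * ρ ^ (n0 + (n + 1))) (c * ρ ^ (n0 + n))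
  have hdisj : Pairwise (Function.onFun Disjoint s) := by
    have := hanti.pairwise_disjoint_on_Ioc_succ
    simpa [s, Function.onFun] using this
  have hterm : ∀ n, continuityModulus p (c * ρ ^ (n0 + (n + 1))) * ENNReal.ofReal (1 - ρ) ≤
      ∫⁻ t in s n, continuityModulus p t / ENNReal.ofReal t := by
    intro n
    have hb := hpos (n0 + n)
    have hvol : volume (s n) = ENNReal.ofReal (c * ρ ^ (n0 + n)) * ENNReal.ofReal (1 - ρ) := by
      rw [Real.volume_Ioc, ← ENNReal.ofReal_mul hb.le]
      congr 1
      ring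
    calc _ = ∫⁻ _ in s n, continuityModulus p (c * ρ ^ (n0 + (n + 1))) /
            ENNReal.ofReal (c * ρ ^ (n0 + n)) := by
          rw [setLIntegral_const, hvol, ← mul_assoc, ENNReal.div_mul_cancel]
          · simpa using hb
          · exact ENNReal.ofReal_ne_top
      _ ≤ _ := by
          refine setLIntegral_mono' measurableSet_Ioc fun t ht => ?_
          exact ENNReal.div_le_div (continuityModulus_mono p ht.1.le)
            (ENNReal.ofReal_le_ofReal ht.2)
  have hsum : (∑' n, continuityModulus p (c * ρ ^ (n0 + (n + 1)))) * ENNReal.ofReal (1 - ρ) < ∞ := by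
    rw [← ENNReal.tsum_mul_right]
    refine (ENNReal.tsum_le_tsum hterm).trans_lt ?_
    rw [← lintegral_iUnion (fun n => measurableSet_Ioc) hdisj]
    refine (lintegral_mono_set ?_).trans_lt hint
    refine Set.iUnion_subset fun n t ht => ⟨(hpos _).trans ht.1, ht.2.trans ?_⟩
    have := hanti (Nat.zero_le n)
    simp only [add_zero] at this
    exact this.trans hn0.le
  have hfin : (∑' n, continuityModulus p (c * ρ ^ (n0 + (n + 1)))) ≠ ∞ := by
    intro htop
    rw [htop, ENNReal.top_mul (by simpa using h1)] at hsum
    exact lt_irrefl _ hsum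
  have := ENNReal.summable_toReal hfin
  rw [← summable_nat_add_iff (n0 + 1)]
  refine this.congr fun n => ?_
  rw [show n0 + (n + 1) = n + (n0 + 1) by ring]

/-! ### A renewal recursion -/

/-- The recursion `w (k + 1) n = (1 - ψ n) w k (n + 1) + ψ n w k 0`: from level `n` one climbs to
level `n + 1` with probability `1 - ψ n` and falls back to level `0` with probability `ψ n`. -/
def renewal (ψ w₀ : ℕ → ℝ) : ℕ → ℕ → ℝ
  | 0 => w₀
  | k + 1 => fun n => (1 - ψ n) * renewal ψ w₀ k (n + 1) + ψ n * renewal ψ w₀ k 0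

section Renewal

variable {ψ w₀ : ℕ → ℝ}

theorem renewal_nonneg (h0 : ∀ n, 0 ≤ ψ n) (h1 : ∀ n, ψ n ≤ 1) (hw : ∀ n, 0 ≤ w₀ n) (k n : ℕ) :
    0 ≤ renewal ψ w₀ k n := by
  induction k generalizing n with
  | zero => exact hw n
  | succ k ih =>
    exact add_nonneg (mul_nonneg (sub_nonneg.2 (h1 n)) (ih _)) (mul_nonneg (h0 n) (ih _))

/-- With w the function after k steps, the new difference between levels n and n + 1 is (1 - ψ
(n+1)) (w (n+1) - w (n+2)) + (ψ n - ψ (n+1)) (w 0 - w (n+1)), a sum of nonnegative terms. -/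
theorem renewal_antitone (h1 : ∀ n, ψ n ≤ 1) (hψ : Antitone ψ)
    (hw : Antitone w₀) (k : ℕ) : Antitone (renewal ψ w₀ k) := by
  induction k with
  | zero => exact hw
  | succ k ih =>
    refine antitone_nat_of_succ_le fun n => ?_
    have a1 := ih (Nat.le_succ (n + 1))
    have a2 := ih (Nat.zero_le (n + 1))
    have a3 := hψ (Nat.le_succ n)
    simp only [renewal]
    nlinarith [h1 (n + 1), mul_nonneg (sub_nonneg.2 a3) (sub_nonneg.2 a2),
      mul_nonneg (sub_nonneg.2 (h1 (n + 1))) (sub_nonneg.2 a1)]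

theorem renewal_zero_antitone (h1 : ∀ n, ψ n ≤ 1) (hψ : Antitone ψ)
    (hw : Antitone w₀) : Antitone fun k => renewal ψ w₀ k 0 := by
  refine antitone_nat_of_succ_le fun k => ?_
  have := renewal_antitone h1 hψ hw k (Nat.zero_le 1)
  simp only [renewal]
  nlinarith [h1 0]

/-- Either all i climbs succeed, or the first fall occurs at some climb j < i, with chance at most ψ
(n + j). After a fall at least k steps remain, and the value at level 0 decreases in time. -/
theorem renewal_add_le (h0 : ∀ n, 0 ≤ ψ n) (h1 : ∀ n, ψ n ≤ 1) (hψ : Antitone ψ)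
    (hw : Antitone w₀) (hw0 : ∀ n, 0 ≤ w₀ n) (k i n : ℕ) :
    renewal ψ w₀ (k + i) n ≤
      renewal ψ w₀ k (n + i) + renewal ψ w₀ k 0 * ∑ j ∈ Finset.range i, ψ (n + j) := by
  induction i generalizing n with
  | zero => simp
  | succ i ih =>
    have e := ih (n + 1)
    have a1 : renewal ψ w₀ (k + i) 0 ≤ renewal ψ w₀ k 0 :=
      renewal_zero_antitone h1 hψ hw (Nat.le_add_right k i)
    have a2 := renewal_nonneg h0 h1 hw0 (k + i) (n + 1)
    rw [Finset.sum_range_succ', ← add_assoc, renewal]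
    have e2 : ∀ j, n + (j + 1) = n + 1 + j := fun j => by ring
    rw [Finset.sum_congr rfl fun j _ => congrArg ψ (e2 j), e2 i, add_zero]
    nlinarith [mul_nonneg (h0 n) a2, mul_nonneg (h0 n) (sub_nonneg.2 a1)]

/-- Same decomposition, with the exact chance of i successful climbs. From level 0 the union bound
may exceed 1, while the product stays positive. -/
theorem renewal_add_le_prod (h0 : ∀ n, 0 ≤ ψ n) (h1 : ∀ n, ψ n ≤ 1) (hψ : Antitone ψ)
    (hw : Antitone w₀) (k i n : ℕ) :
    renewal ψ w₀ (k + i) n ≤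
      (∏ j ∈ Finset.range i, (1 - ψ (n + j))) * renewal ψ w₀ k (n + i) +
        (1 - ∏ j ∈ Finset.range i, (1 - ψ (n + j))) * renewal ψ w₀ k 0 := by
  induction i generalizing n with
  | zero => simp
  | succ i ih =>
    have e := ih (n + 1)
    have a1 : renewal ψ w₀ (k + i) 0 ≤ renewal ψ w₀ k 0 :=
      renewal_zero_antitone h1 hψ hw (Nat.le_add_right k i)
    rw [Finset.prod_range_succ', ← add_assoc, renewal]
    have e2 : ∀ j, n + (j + 1) = n + 1 + j := fun j => by ring
    rw [Finset.prod_congr rfl fun j _ => congrArg (fun i => 1 - ψ i) (e2 j), e2 i, add_zero]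
    nlinarith [mul_le_mul_of_nonneg_left e (sub_nonneg.2 (h1 n)),
      mul_le_mul_of_nonneg_left a1 (h0 n)]

/-- If the probabilities to fall back are summable and bounded away from `1`, the recursion tends
to `0`: the renewal chain is transient. -/
theorem tendsto_renewal {d : ℝ} (hd : 0 < d) (h0 : ∀ n, 0 ≤ ψ n) (hd1 : ∀ n, ψ n ≤ 1 - d)
    (hψ : Antitone ψ) (hs : Summable ψ) (hw : Antitone w₀) (hlim : Tendsto w₀ atTop (𝓝 0)) :
    Tendsto (fun k => renewal ψ w₀ k 0) atTop (𝓝 0) := by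
  have h1 : ∀ n, ψ n ≤ 1 := fun n => (hd1 n).trans (by linarith)
  have hw0 : ∀ n, 0 ≤ w₀ n := fun n => hw.le_of_tendsto hlim n
  have hnn := renewal_nonneg h0 h1 hw0
  have hanti := renewal_zero_antitone h1 hψ hw
  have hbdd : BddBelow (Set.range fun k => renewal ψ w₀ k 0) :=
    ⟨0, by rintro _ ⟨k, rfl⟩; exact hnn k 0⟩
  have ha := tendsto_atTop_ciInf hanti hbdd
  set a := ⨅ k, renewal ψ w₀ k 0
  have hage : ∀ k, a ≤ renewal ψ w₀ k 0 := fun k => ciInf_le hbdd k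
  have hann : 0 ≤ a := le_ciInf fun k => hnn k 0
  have htail : Tendsto (fun n => ∑' j, ψ (j + n)) atTop (𝓝 0) := tendsto_sum_nat_add ψ
  have hpart : ∀ n i, ∑ j ∈ Finset.range i, ψ (n + j) ≤ ∑' j, ψ (j + n) := fun n i => by
    simp only [add_comm n]
    exact ((summable_nat_add_iff n).2 hs).sum_le_tsum _ fun j _ => h0 _
  suffices hz : a = 0 by rwa [hz] at ha
  by_contra hne
  have hapos : 0 < a := lt_of_le_of_ne hann (Ne.symm hne)
  -- From level `n₁`, a fall ever occurs with chance below 1/2, and `π` is the positive chance to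
  -- climb there from level 0. So some definite fraction of the mass escapes, which is incompatible
  -- with a positive limit `a`.
  obtain ⟨n₁, hn₁⟩ := (htail.eventually (gt_mem_nhds (show (0 : ℝ) < 1 / 2 by norm_num))).exists
  set π := ∏ j ∈ Finset.range n₁, (1 - ψ (0 + j)) with hπ
  have hπ0 : 0 < π := Finset.prod_pos fun j _ => by linarith [hd1 (0 + j)]
  have hπ1 : π ≤ 1 := Finset.prod_le_one (fun j _ => by linarith [h1 (0 + j)])
    fun j _ => by linarith [h0 (0 + j)]
  obtain ⟨k, hk⟩ := (ha.eventually (gt_mem_nhds (show a < a * (1 + π / 4) by nlinarith))).exists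
  -- For fixed `k`, a start at a high level either stays high for `k` steps or falls, with chance
  -- bounded by the tail sum of `ψ`.
  have hwk : Tendsto (renewal ψ w₀ k) atTop (𝓝 0) := by
    have hb : Tendsto (fun n => w₀ (n + k) + w₀ 0 * ∑' j, ψ (j + n)) atTop (𝓝 (0 + w₀ 0 * 0)) :=
      ((tendsto_add_atTop_iff_nat k).2 hlim).add (htail.const_mul _)
    rw [mul_zero, add_zero] at hb
    refine squeeze_zero (hnn k) (fun n => ?_) hb
    have := renewal_add_le h0 h1 hψ hw hw0 0 k n
    rw [zero_add] at this
    exact this.trans (add_le_add le_rfl (mul_le_mul_of_nonneg_left (hpart n k) (hw0 0)))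
  obtain ⟨i, hi⟩ := (((tendsto_add_atTop_iff_nat n₁).2 hwk).eventually
    (gt_mem_nhds (show 0 < π / 4 * a by positivity))).exists
  have b1 := renewal_add_le h0 h1 hψ hw hw0 k i n₁
  have b2 := mul_le_mul_of_nonneg_left ((hpart n₁ i).trans hn₁.le) (hnn k 0)
  have b3 := renewal_add_le_prod h0 h1 hψ hw (k + i) n₁ 0
  have b4 : renewal ψ w₀ (k + i) 0 ≤ renewal ψ w₀ k 0 := hanti (Nat.le_add_right k i)
  have b5 := hage (k + i + n₁)
  rw [← hπ, zero_add] at b3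
  rw [add_comm n₁ i] at b1
  have b6 : renewal ψ w₀ (k + i) n₁ ≤ π / 4 * a + a * (1 + π / 4) * (1 / 2) := by linarith
  have b7 : a ≤ π * (π / 4 * a + a * (1 + π / 4) * (1 / 2)) + (1 - π) * (a * (1 + π / 4)) :=
    (b5.trans b3).trans (add_le_add (mul_le_mul_of_nonneg_left b6 hπ0.le)
      (mul_le_mul_of_nonneg_left (b4.trans hk.le) (by linarith)))
  -- The right side equals 1 - π/4 + π²/8, which is below 1 for 0 < π ≤ 1.
  have b8 : 1 ≤ π * (π / 4 + (1 + π / 4) * (1 / 2)) + (1 - π) * (1 + π / 4) := by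
    refine le_of_mul_le_mul_left (a := a) ?_ hapos
    linarith
  nlinarith

end Renewal

/-! ### Comparison of two averages -/

/-- This is the estimate from a maximal coupling of the weights: the common mass min (a m) (b m)
uses the same index on both sides and costs `r`, the remaining mass costs `R`. -/
theorem sum_mul_sub_sum_mul_le {M : Type*} [Fintype M] {a b u v : M → ℝ} {r R θ : ℝ}
    (ha : ∑ m, a m = 1) (hb : ∑ m, b m = 1) (h0 : ∀ m, 0 ≤ a m) (h0' : ∀ m, 0 ≤ b m)
    (hr : ∀ m, |u m - v m| ≤ r) (hR : ∀ m m', |u m - v m'| ≤ R) (hrR : r ≤ R)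
    (hθ : 1 - θ ≤ ∑ m, min (a m) (b m)) :
    ∑ m, a m * u m - ∑ m, b m * v m ≤ (1 - θ) * r + θ * R := by
  have hne : (Finset.univ : Finset M).Nonempty := by
    rw [Finset.nonempty_iff_ne_empty]
    intro h
    rw [h, Finset.sum_empty] at ha
    exact zero_ne_one ha
  -- No coupling is constructed. The excess masses of `a` and `b` are both compared with the minimum
  -- of `v`; since the totals agree, the terms with `v m₀` cancel after summation.
  obtain ⟨m₀, -, hm₀⟩ := Finset.exists_min_image Finset.univ v hne
  have hterm : ∀ m, a m * u m - b m * v m ≤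
      min (a m) (b m) * (r - R) + a m * R + (a m - b m) * v m₀ := by
    intro m
    have c1 := (abs_le.1 (hr m)).2
    have c2 := (abs_le.1 (hR m m₀)).2
    have c3 := hm₀ m (Finset.mem_univ m)
    have c4 : 0 ≤ min (a m) (b m) := le_min (h0 m) (h0' m)
    have c5 := min_le_left (a m) (b m)
    have c6 := min_le_right (a m) (b m)
    nlinarith [mul_nonneg c4 (sub_nonneg.2 c1), mul_nonneg (sub_nonneg.2 c5) (sub_nonneg.2 c2),
      mul_nonneg (sub_nonneg.2 c6) (sub_nonneg.2 c3)]
  have hsum := Finset.sum_le_sum fun m (_ : m ∈ Finset.univ) => hterm m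
  rw [Finset.sum_sub_distrib, Finset.sum_add_distrib, Finset.sum_add_distrib, ← Finset.sum_mul,
    ← Finset.sum_mul, ← Finset.sum_mul, Finset.sum_sub_distrib, ha, hb] at hsum
  nlinarith

theorem abs_sum_mul_sub_sum_mul_le {M : Type*} [Fintype M] {a b u v : M → ℝ} {r R θ : ℝ}
    (ha : ∑ m, a m = 1) (hb : ∑ m, b m = 1) (h0 : ∀ m, 0 ≤ a m) (h0' : ∀ m, 0 ≤ b m)
    (hr : ∀ m, |u m - v m| ≤ r) (hR : ∀ m m', |u m - v m'| ≤ R) (hrR : r ≤ R)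
    (hθ : 1 - θ ≤ ∑ m, min (a m) (b m)) :
    |∑ m, a m * u m - ∑ m, b m * v m| ≤ (1 - θ) * r + θ * R := by
  refine abs_sub_le_iff.2 ⟨sum_mul_sub_sum_mul_le ha hb h0 h0' hr hR hrR hθ,
    sum_mul_sub_sum_mul_le hb ha h0' h0 (fun m => ?_) (fun m m' => ?_) hrR ?_⟩
  · rw [abs_sub_comm]; exact hr m
  · rw [abs_sub_comm]; exact hR m' m
  · simpa only [min_comm] using hθ

/-- A continuous function on a compact set has a modulus of continuity along every antitone
sequence of scales that tends to `0`. -/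
theorem IsCompact.exists_modulus {S : Type*} [PseudoMetricSpace S] {K : Set S} (hK : IsCompact K)
    {g : S → ℝ} (hg : ContinuousOn g K) {t : ℕ → ℝ} (ht : Antitone t)
    (ht0 : Tendsto t atTop (𝓝 0)) :
    ∃ w : ℕ → ℝ, Antitone w ∧ Tendsto w atTop (𝓝 0) ∧
      ∀ n, ∀ x ∈ K, ∀ y ∈ K, dist x y ≤ t n → |g x - g y| ≤ w n := by
  obtain ⟨C, hC⟩ := hK.exists_bound_of_continuousOn hg
  let s : ℕ → Set ℝ := fun n => {d | ∃ x ∈ K, ∃ y ∈ K, dist x y ≤ t n ∧ |g x - g y| = d}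
  have hbdd : ∀ n, BddAbove (s n) := by
    refine fun n => ⟨C + C, ?_⟩
    rintro _ ⟨x, hx, y, hy, -, rfl⟩
    exact (abs_sub _ _).trans (add_le_add (hC x hx) (hC y hy))
  have hnn : ∀ n, 0 ≤ sSup (s n) := fun n => Real.sSup_nonneg (by
    rintro _ ⟨x, hx, y, hy, -, rfl⟩; exact abs_nonneg _)
  refine ⟨fun n => sSup (s n), fun m n hmn => ?_, ?_, fun n x hx y hy hxy =>
    le_csSup (hbdd n) ⟨x, hx, y, hy, hxy, rfl⟩⟩
  · refine Real.sSup_le ?_ (hnn m)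
    rintro _ ⟨x, hx, y, hy, hxy, rfl⟩
    exact le_csSup (hbdd m) ⟨x, hx, y, hy, hxy.trans (ht hmn), rfl⟩
  · rw [Metric.tendsto_atTop]
    intro ε hε
    have huc := hK.uniformContinuousOn_of_continuous hg
    obtain ⟨η, hη, hU⟩ := Metric.uniformContinuousOn_iff.1 huc (ε / 2) (by positivity)
    obtain ⟨n0, hn0⟩ := eventually_atTop.1 (ht0.eventually (gt_mem_nhds hη))
    refine ⟨n0, fun n hn => ?_⟩
    rw [Real.dist_eq, sub_zero, abs_of_nonneg (hnn n)]
    refine lt_of_le_of_lt (Real.sSup_le ?_ (by positivity)) (half_lt_self hε)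
    rintro _ ⟨x, hx, y, hy, hxy, rfl⟩
    exact (hU x hx y hy (hxy.trans_lt (hn0 n hn))).le

/-! ### An adapted norm for Schur matrices -/

attribute [local instance] Matrix.linftyOpNormedRing Matrix.linftyOpNormedAlgebra

/-- Gelfand's formula for the complexified matrix: if the spectral radius lies below ρ, some
positive power has norm at most the same power of ρ. -/
theorem IsSchur.exists_norm_pow_lt {n : ℕ} {A : Matrix (Fin n) (Fin n) ℝ} (hA : IsSchur A) :
    ∃ ρ : ℝ, 0 < ρ ∧ ρ < 1 ∧ ∃ k : ℕ, ∀ x : Fin n → ℝ, ‖(A ^ (k + 1)).mulVec x‖ ≤ ρ ^ (k + 1) * ‖x‖ := by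
  -- In dimension 0 the matrix ring is trivial and the spectrum is empty.
  rcases Nat.eq_zero_or_pos n with rfl | hn
  · exact ⟨1 / 2, by norm_num, by norm_num, 0, fun x => by
      rw [Subsingleton.elim x 0]; simp only [Matrix.mulVec_zero, norm_zero, mul_zero, le_refl]⟩
  have : Nonempty (Fin n) := ⟨⟨0, hn⟩⟩
  set B := A.map (algebraMap ℝ ℂ)
  have h1 : spectralRadius ℂ B < (1 : ℝ≥0) :=
    spectrum.spectralRadius_lt_of_forall_lt B fun z hz => by
      rw [← NNReal.coe_lt_coe]; exact hA z hz
  obtain ⟨ρ, hρ, hρ1⟩ := ENNReal.lt_iff_exists_nnreal_btwn.1 h1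
  have h2 := spectrum.pow_nnnorm_pow_one_div_tendsto_nhds_spectralRadius B
  obtain ⟨k, hk, hk0⟩ := ((h2.eventually (gt_mem_nhds hρ)).and (eventually_gt_atTop 0)).exists
  have hpow : ‖B ^ k‖₊ ≤ ρ ^ k := by
    have h3 : ((‖B ^ k‖₊ : ℝ≥0∞) ^ (1 / k : ℝ)) ^ (k : ℝ) ≤ (ρ : ℝ≥0∞) ^ (k : ℝ) :=
      ENNReal.rpow_le_rpow hk.le (Nat.cast_nonneg k)
    have hk1 : (1 / k : ℝ) * k = 1 := one_div_mul_cancel (by exact_mod_cast hk0.ne')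
    rw [← ENNReal.rpow_mul, hk1, ENNReal.rpow_one, ENNReal.rpow_natCast] at h3
    exact_mod_cast h3
  have hnorm : ‖A ^ k‖₊ = ‖B ^ k‖₊ := by
    have : B ^ k = (A ^ k).map (algebraMap ℝ ℂ) := ((algebraMap ℝ ℂ).mapMatrix.map_pow A k).symm
    rw [this, Matrix.linfty_opNNNorm_def, Matrix.linfty_opNNNorm_def]
    simp
  obtain ⟨k, rfl⟩ := Nat.exists_eq_succ_of_ne_zero hk0.ne'
  refine ⟨ρ, ?_, by exact_mod_cast hρ1, k, fun x => ?_⟩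
  · exact_mod_cast (zero_le (a := spectralRadius ℂ B)).trans_lt hρ
  · refine (Matrix.linfty_opNorm_mulVec _ _).trans ?_
    refine mul_le_mul_of_nonneg_right ?_ (norm_nonneg x)
    exact_mod_cast hnorm.trans_le hpow

/-- A Schur matrix is a strict contraction for some norm. -/
theorem IsSchur.exists_seminorm {n : ℕ} {A : Matrix (Fin n) (Fin n) ℝ} (hA : IsSchur A) :
    ∃ (ρ : ℝ) (C : ℝ) (q : Seminorm ℝ (Fin n → ℝ)), 0 < ρ ∧ ρ < 1 ∧ 0 ≤ C ∧ (∀ x, ‖x‖ ≤ q x) ∧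
      (∀ x, q x ≤ C * ‖x‖) ∧ ∀ x, q (A.mulVec x) ≤ ρ * q x := by
  obtain ⟨ρ, h0, h1, k, hk⟩ := hA.exists_norm_pow_lt
  have hmv : ∀ j x, ‖(A ^ j).mulVec x‖ ≤ ‖A ^ j‖ * ‖x‖ := fun j x => Matrix.linfty_opNorm_mulVec _ _
  have happ : ∀ j x, (A ^ j).mulVec (A.mulVec x) = (A ^ (j + 1)).mulVec x := fun j x => by
    rw [Matrix.mulVec_mulVec, pow_succ]
  -- Applying `A` shifts the sum by one index and costs a factor ρ. The new last term ρ^(-k)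
  -- ‖A^(k+1) x‖ is at most ρ ‖x‖, and so takes the place of the lost term j = 0.
  let q : Seminorm ℝ (Fin n → ℝ) := Seminorm.of
    (fun x => ∑ j ∈ Finset.range (k + 1), (ρ ^ j)⁻¹ * ‖(A ^ j).mulVec x‖)
    (fun x y => by
      rw [← Finset.sum_add_distrib]
      refine Finset.sum_le_sum fun j _ => ?_
      rw [← mul_add, Matrix.mulVec_add]
      exact mul_le_mul_of_nonneg_left (norm_add_le _ _) (by positivity))
    (fun a x => by
      rw [Finset.mul_sum]
      refine Finset.sum_congr rfl fun j _ => ?_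
      rw [Matrix.mulVec_smul, norm_smul]
      ring)
  have hq : ∀ x, q x = ∑ j ∈ Finset.range (k + 1), (ρ ^ j)⁻¹ * ‖(A ^ j).mulVec x‖ := fun x => rfl
  refine ⟨ρ, ∑ j ∈ Finset.range (k + 1), (ρ ^ j)⁻¹ * ‖A ^ j‖, q, h0, h1, by positivity,
    fun x => ?_, fun x => ?_, fun x => ?_⟩
  · rw [hq, Finset.sum_range_succ']
    simp only [pow_zero, inv_one, one_mul, Matrix.one_mulVec]
    have : 0 ≤ ∑ j ∈ Finset.range k, (ρ ^ (j + 1))⁻¹ * ‖(A ^ (j + 1)).mulVec x‖ := by positivity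
    linarith
  · rw [hq, Finset.sum_mul]
    refine Finset.sum_le_sum fun j _ => ?_
    rw [mul_assoc]
    exact mul_le_mul_of_nonneg_left (hmv j x) (by positivity)
  · have h2 : (ρ ^ k)⁻¹ * ‖(A ^ (k + 1)).mulVec x‖ ≤ ρ * ‖x‖ := by
      rw [inv_mul_le_iff₀ (by positivity), ← mul_assoc, ← pow_succ]
      exact hk x
    simp only [hq, happ]
    rw [Finset.sum_range_succ, Finset.sum_range_succ' _ k, mul_add, Finset.mul_sum]
    refine add_le_add (Finset.sum_le_sum fun j _ => le_of_eq ?_) (by simpa using h2)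
    rw [pow_succ ρ]
    field_simp

namespace IFS

/-! ### The transfer operator -/

section Transfer

variable {S : Type*} [MeasurableSpace S] {M : Type*} [Fintype M] (I : IFS S M)

/-- The action of the chain on functions: `(T g) x` is the expectation of `g` after one step
from `x`. -/
noncomputable def transfer (g : S → ℝ) (x : S) : ℝ := ∑ m, I.q m x * g (I.f m x)

theorem integral_kernel {g : S → ℝ} (hg : Measurable g) (x : S) :
    ∫ y, g y ∂(I.kernel x) = I.transfer g x := by
  change ∫ y, g y ∂(∑ m, ENNReal.ofReal (I.q m x) • Measure.dirac (I.f m x)) = _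
  have hint : ∀ m, Integrable g (Measure.dirac (I.f m x)) := fun m =>
    integrable_dirac' hg.stronglyMeasurable (by simp)
  rw [integral_finsetSum_measure fun m _ => (hint m).smul_measure ENNReal.ofReal_ne_top]
  refine Finset.sum_congr rfl fun m _ => ?_
  rw [integral_smul_measure, integral_dirac' _ _ hg.stronglyMeasurable,
    ENNReal.toReal_ofReal (I.q_nonneg m x), smul_eq_mul]

theorem measurable_transfer {g : S → ℝ} (hg : Measurable g) : Measurable (I.transfer g) :=
  Finset.measurable_sum _ fun m _ => (I.measurable_q m).mul (hg.comp (I.measurable_f m))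

theorem measurable_transfer_iterate {g : S → ℝ} (hg : Measurable g) (k : ℕ) :
    Measurable (I.transfer^[k] g) := by
  induction k with
  | zero => exact hg
  | succ k ih => rw [Function.iterate_succ_apply']; exact I.measurable_transfer ih

/-- Averages over a forward invariant set stay within the bounds of the function there. -/
theorem abs_transfer_sub_le {K : Set S} (hK : ∀ m, ∀ x ∈ K, I.f m x ∈ K) {g : S → ℝ} {c b : ℝ}
    (hg : ∀ x ∈ K, |g x - c| ≤ b) : ∀ x ∈ K, |I.transfer g x - c| ≤ b := by
  intro x hx
  have e1 : I.transfer g x - c = ∑ m, I.q m x * (g (I.f m x) - c) := by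
    simp only [mul_sub, Finset.sum_sub_distrib, ← Finset.sum_mul, I.q_sum, one_mul, transfer]
  have e2 : b = ∑ m, I.q m x * b := by rw [← Finset.sum_mul, I.q_sum, one_mul]
  rw [e1, e2]
  refine (Finset.abs_sum_le_sum_abs _ _).trans (Finset.sum_le_sum fun m _ => ?_)
  rw [abs_mul, abs_of_nonneg (I.q_nonneg m x)]
  exact mul_le_mul_of_nonneg_left (hg _ (hK m x hx)) (I.q_nonneg m x)

theorem abs_transfer_iterate_sub_le {K : Set S} (hK : ∀ m, ∀ x ∈ K, I.f m x ∈ K) {g : S → ℝ}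
    {c b : ℝ} (hg : ∀ x ∈ K, |g x - c| ≤ b) (k : ℕ) :
    ∀ x ∈ K, |I.transfer^[k] g x - c| ≤ b := by
  induction k with
  | zero => exact hg
  | succ k ih => rw [Function.iterate_succ_apply']; exact I.abs_transfer_sub_le hK ih

theorem abs_transfer_iterate_le {g : S → ℝ} {b : ℝ} (hg : ∀ x, |g x| ≤ b) (k : ℕ) (x : S) :
    |I.transfer^[k] g x| ≤ b := by
  simpa using I.abs_transfer_iterate_sub_le (K := Set.univ) (fun _ _ _ => Set.mem_univ _) (c := 0)
    (fun x _ => by simpa using hg x) k x (Set.mem_univ x)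

theorem integral_step {g : S → ℝ} (hg : Measurable g) {b : ℝ} (hb : ∀ x, |g x| ≤ b)
    (ν : ProbabilityMeasure S) :
    ∫ x, g x ∂(MarkovChain.step I.kernel ν : Measure S) = ∫ x, I.transfer g x ∂(ν : Measure S) := by
  have hint : Integrable g ((ν : Measure S).bind I.kernel) :=
    Integrable.of_bound hg.aestronglyMeasurable b (ae_of_all _ hb)
  change ∫ x, g x ∂((ν : Measure S).bind I.kernel) = _
  rw [Measure.comp_eq_comp_const_apply] at hint ⊢
  rw [Kernel.integral_comp hint, Kernel.const_apply]
  exact integral_congr_ae (ae_of_all _ fun x => I.integral_kernel hg x)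

theorem integral_step_iterate {g : S → ℝ} (hg : Measurable g) {b : ℝ} (hb : ∀ x, |g x| ≤ b)
    (ν : ProbabilityMeasure S) (k : ℕ) :
    ∫ x, g x ∂((MarkovChain.step I.kernel)^[k] ν : Measure S) =
      ∫ x, I.transfer^[k] g x ∂(ν : Measure S) := by
  induction k generalizing g with
  | zero => rfl
  | succ k ih =>
    rw [Function.iterate_succ_apply', I.integral_step hg hb, Function.iterate_succ_apply,
      ih (I.measurable_transfer hg) (fun x => I.abs_transfer_iterate_le hb 1 x)]

theorem kernel_compl_eq_zero {K : Set S} (hKm : MeasurableSet K)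
    (hK : ∀ m, ∀ x ∈ K, I.f m x ∈ K) {x : S} (hx : x ∈ K) : I.kernel x Kᶜ = 0 := by
  change (∑ m, ENNReal.ofReal (I.q m x) • Measure.dirac (I.f m x)) Kᶜ = 0
  simp only [Measure.coe_finsetSum, Finset.sum_apply, Measure.smul_apply, smul_eq_mul,
    Measure.dirac_apply' _ hKm.compl]
  refine Finset.sum_eq_zero fun m _ => ?_
  simp [hK m x hx]

theorem step_compl_eq_zero {K : Set S} (hKm : MeasurableSet K)
    (hK : ∀ m, ∀ x ∈ K, I.f m x ∈ K) {ν : ProbabilityMeasure S} (hν : (ν : Measure S) Kᶜ = 0) :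
    (MarkovChain.step I.kernel ν : Measure S) Kᶜ = 0 := by
  change ((ν : Measure S).bind I.kernel) Kᶜ = 0
  rw [Measure.bind_apply hKm.compl I.kernel.measurable.aemeasurable,
    lintegral_eq_zero_iff (I.kernel.measurable_coe hKm.compl)]
  filter_upwards [measure_eq_zero_iff_ae_notMem.1 hν] with x hx
  exact I.kernel_compl_eq_zero hKm hK (not_not.1 hx)

end Transfer

/-! ### Contracting systems -/

/-- The maps are uniform contractions for a gauge `V` that is equivalent to the distance, the
probabilities are bounded below, and their modulus of continuity `Φ` with respect to `V` is summable
along geometric scales. -/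
structure Contracting {S : Type*} [MeasurableSpace S] [PseudoMetricSpace S] {M : Type*} [Fintype M]
    (I : IFS S M) (V : S → S → ℝ) (C ρ d : ℝ) (Φ : ℝ → ℝ) : Prop where
  symm : ∀ x y, V x y = V y x
  triangle : ∀ x y z, V x z ≤ V x y + V y z
  dist_le : ∀ x y, dist x y ≤ V x y
  le_dist : ∀ x y, V x y ≤ C * dist x y
  C_nonneg : 0 ≤ C
  ρ_pos : 0 < ρ
  ρ_lt : ρ < 1
  contr : ∀ m x y, V (I.f m x) (I.f m y) ≤ ρ * V x y
  d_pos : 0 < d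
  d_le : ∀ m x, d ≤ I.q m x
  osc : ∀ m x y t, V x y ≤ t → |I.q m x - I.q m y| ≤ Φ t
  Φ_mono : Monotone Φ
  Φ_nonneg : ∀ t, 0 ≤ Φ t
  Φ_summable : ∀ D, 0 < D → Summable fun n : ℕ => Φ (D * ρ ^ n)

namespace Contracting

variable {S : Type*} [MeasurableSpace S] [PseudoMetricSpace S] {M : Type*} [Fintype M]
  {I : IFS S M} {V : S → S → ℝ} {C ρ d : ℝ} {Φ : ℝ → ℝ}

theorem continuous_f (h : I.Contracting V C ρ d Φ) (m : M) : Continuous (I.f m) := by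
  refine LipschitzWith.continuous (K := Real.toNNReal (ρ * C)) (LipschitzWith.of_dist_le_mul
    fun x y => ?_)
  rw [Real.coe_toNNReal _ (mul_nonneg h.ρ_pos.le h.C_nonneg), mul_assoc]
  exact ((h.dist_le _ _).trans (h.contr m x y)).trans
    (mul_le_mul_of_nonneg_left (h.le_dist x y) h.ρ_pos.le)

theorem continuous_q (h : I.Contracting V C ρ d Φ) (m : M) : Continuous (I.q m) := by
  rw [Metric.continuous_iff]
  intro y ε hε
  obtain ⟨n, hn⟩ := ((h.Φ_summable 1 one_pos).tendsto_atTop_zero.eventually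
    (gt_mem_nhds hε)).exists
  have hC : 0 < C + 1 := by linarith [h.C_nonneg]
  have hρ : 0 < ρ ^ n := pow_pos h.ρ_pos n
  -- `C + 1` rather than `C`, which may vanish.
  refine ⟨ρ ^ n / (C + 1), by positivity, fun x hx => ?_⟩
  rw [lt_div_iff₀ hC] at hx
  refine (h.osc m x y (1 * ρ ^ n) ?_).trans_lt hn
  have := h.le_dist x y
  nlinarith [dist_nonneg (x := x) (y := y)]

theorem continuous_transfer (h : I.Contracting V C ρ d Φ) {g : S → ℝ} (hg : Continuous g) :
    Continuous (I.transfer g) :=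
  continuous_finsetSum _ fun m _ => (h.continuous_q m).mul (hg.comp (h.continuous_f m))

theorem continuous_transfer_iterate (h : I.Contracting V C ρ d Φ) {g : S → ℝ} (hg : Continuous g)
    (k : ℕ) : Continuous (I.transfer^[k] g) := by
  induction k with
  | zero => exact hg
  | succ k ih => rw [Function.iterate_succ_apply']; exact h.continuous_transfer ih

theorem continuous_gauge (h : I.Contracting V C ρ d Φ) (z : S) : Continuous fun x => V x z := by
  refine LipschitzWith.continuous (K := Real.toNNReal C) (LipschitzWith.of_dist_le_mul
    fun x y => ?_)
  rw [Real.coe_toNNReal _ h.C_nonneg, Real.dist_eq]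
  refine abs_sub_le_iff.2 ⟨?_, ?_⟩
  · linarith [h.triangle x y z, h.le_dist x y]
  · linarith [h.triangle y x z, h.le_dist x y, h.symm x y]

/-- Any two points lie in a compact forward invariant set. -/
theorem exists_invariant_compact [ProperSpace S] (h : I.Contracting V C ρ d Φ) (x₀ z : S) :
    ∃ K : Set S, IsCompact K ∧ (∀ m, ∀ x ∈ K, I.f m x ∈ K) ∧ x₀ ∈ K ∧ z ∈ K := by
  have hV : ∀ x y, 0 ≤ V x y := fun x y => dist_nonneg.trans (h.dist_le x y)
  have hρ : 0 < 1 - ρ := sub_pos.2 h.ρ_lt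
  set b := ∑ m, V (I.f m z) z
  have hb : ∀ m, V (I.f m z) z ≤ b := fun m =>
    Finset.single_le_sum (f := fun m => V (I.f m z) z) (fun m _ => hV _ _) (Finset.mem_univ m)
  -- The second entry gives ρ R + b ≤ R, so the gauge ball of radius `R` about `z` is mapped into
  -- itself.
  set R := max (V x₀ z) (b / (1 - ρ))
  have hR : b ≤ R * (1 - ρ) := (div_le_iff₀ hρ).1 (le_max_right _ _)
  refine ⟨{x | V x z ≤ R}, ?_, fun m x hx => ?_, show V x₀ z ≤ R from le_max_left _ _, ?_⟩
  · refine Metric.isCompact_of_isClosed_isBounded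
      (isClosed_le (h.continuous_gauge z) continuous_const) ?_
    exact Metric.isBounded_closedBall.subset (fun x hx => (h.dist_le x z).trans hx)
  · have hx' : V x z ≤ R := hx
    change V (I.f m x) z ≤ R
    have := h.triangle (I.f m x) (I.f m z) z
    nlinarith [h.contr m x z, hb m, h.ρ_pos]
  · have h1 := h.le_dist z z
    rw [dist_self, mul_zero] at h1
    exact h1.trans ((hV x₀ z).trans (le_max_left _ _))

/-- The iterates of a continuous function under the transfer operator have vanishing oscillation on
compact forward invariant sets. -/
theorem exists_oscillation_bound (h : I.Contracting V C ρ d Φ) {K : Set S} (hKc : IsCompact K)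
    (hK : ∀ m, ∀ x ∈ K, I.f m x ∈ K) {g : S → ℝ} (hg : Continuous g) :
    ∃ b : ℕ → ℝ, Tendsto b atTop (𝓝 0) ∧
      ∀ k, ∀ x ∈ K, ∀ y ∈ K, |I.transfer^[k] g x - I.transfer^[k] g y| ≤ b k := by
  rcases K.eq_empty_or_nonempty with rfl | ⟨z, hz⟩
  · exact ⟨0, tendsto_const_nhds, by simp⟩
  obtain ⟨D, hD, hKD⟩ : ∃ D : ℝ, 0 < D ∧ ∀ x ∈ K, ∀ y ∈ K, V x y ≤ D := by
    have hd := Metric.diam_nonneg (s := K)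
    refine ⟨C * Metric.diam K + 1, by have := mul_nonneg h.C_nonneg hd; linarith,
      fun x hx y hy => ?_⟩
    have := mul_le_mul_of_nonneg_left (Metric.dist_le_diam_of_mem hKc.isBounded hx hy) h.C_nonneg
    linarith [h.le_dist x y]
  have htanti : Antitone fun n : ℕ => D * ρ ^ n := fun m n hmn =>
    mul_le_mul_of_nonneg_left (pow_le_pow_of_le_one h.ρ_pos.le h.ρ_lt.le hmn) hD.le
  have htlim : Tendsto (fun n : ℕ => D * ρ ^ n) atTop (𝓝 0) := by
    simpa using (tendsto_pow_atTop_nhds_zero_of_lt_one h.ρ_pos.le h.ρ_lt).const_mul D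
  obtain ⟨w₀, hw, hwlim, hmod⟩ := hKc.exists_modulus hg.continuousOn htanti htlim
  set c : ℝ := (Fintype.card M : ℝ) with hc
  have hc0 : 0 ≤ c := Nat.cast_nonneg _
  -- `1 - ψ n` bounds from below the overlap of the choice probabilities at two points of level n.
  -- The floor `d` on a single map gives the first entry; the modulus, summed over the `c` maps,
  -- gives the second.
  let ψ : ℕ → ℝ := fun n => min (1 - d) (c * Φ (D * ρ ^ n))
  have hne : Nonempty M := by
    by_contra hemp
    rw [not_nonempty_iff] at hemp
    simpa using I.q_sum z
  have hd1 : d ≤ 1 := by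
    obtain ⟨m⟩ := hne
    refine (h.d_le m z).trans ?_
    rw [← I.q_sum z]
    exact Finset.single_le_sum (f := fun m => I.q m z) (fun m _ => I.q_nonneg m z)
      (Finset.mem_univ m)
  have hψ0 : ∀ n, 0 ≤ ψ n := fun n => le_min (by linarith) (mul_nonneg hc0 (h.Φ_nonneg _))
  have hψd : ∀ n, ψ n ≤ 1 - d := fun n => min_le_left _ _
  have hψ1 : ∀ n, ψ n ≤ 1 := fun n => (hψd n).trans (by linarith [h.d_pos])
  have hψa : Antitone ψ := fun m n hmn => min_le_min le_rfl
    (mul_le_mul_of_nonneg_left (h.Φ_mono (htanti hmn)) hc0)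
  have hψs : Summable ψ := Summable.of_nonneg_of_le hψ0 (fun n => min_le_right _ _)
    ((h.Φ_summable D hD).mul_left c)
  -- Agreement of the maps sends level n to level n + 1, and any disagreement is charged to level 0,
  -- where `D` bounds all gauge distances in `K`.
  have hmain : ∀ k n, ∀ x ∈ K, ∀ y ∈ K, V x y ≤ D * ρ ^ n →
      |I.transfer^[k] g x - I.transfer^[k] g y| ≤ renewal ψ w₀ k n := by
    intro k
    induction k with
    | zero => exact fun n x hx y hy hxy => hmod n x hx y hy ((h.dist_le x y).trans hxy)
    | succ k ih =>
      intro n x hx y hy hxy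
      rw [Function.iterate_succ_apply']
      have hr0 : renewal ψ w₀ k (n + 1) ≤ renewal ψ w₀ k 0 :=
        renewal_antitone hψ1 hψa hw k (Nat.zero_le _)
      refine abs_sum_mul_sub_sum_mul_le (I.q_sum x) (I.q_sum y) (fun m => I.q_nonneg m x)
        (fun m => I.q_nonneg m y) (fun m => ih (n + 1) _ (hK m x hx) _ (hK m y hy) ?_)
        (fun m m' => ih 0 _ (hK m x hx) _ (hK m' y hy) ?_) hr0 ?_
      · calc _ ≤ ρ * V x y := h.contr m x y
          _ ≤ ρ * (D * ρ ^ n) := mul_le_mul_of_nonneg_left hxy h.ρ_pos.le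
          _ = _ := by ring
      · simpa using hKD _ (hK m x hx) _ (hK m' y hy)
      · have h1 : 1 - c * Φ (D * ρ ^ n) ≤ ∑ m, min (I.q m x) (I.q m y) := by
          have e1 : ∑ _m : M, Φ (D * ρ ^ n) = c * Φ (D * ρ ^ n) := by simp [hc]
          rw [← I.q_sum x, ← e1, ← Finset.sum_sub_distrib]
          refine Finset.sum_le_sum fun m _ => le_min ?_ ?_
          · linarith [h.Φ_nonneg (D * ρ ^ n)]
          · linarith [(abs_le.1 (h.osc m x y _ hxy)).2]
        have h2 : d ≤ ∑ m, min (I.q m x) (I.q m y) := by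
          obtain ⟨m⟩ := hne
          refine (le_min (h.d_le m x) (h.d_le m y)).trans ?_
          exact Finset.single_le_sum (f := fun m => min (I.q m x) (I.q m y))
            (fun m _ => le_min (I.q_nonneg m x) (I.q_nonneg m y)) (Finset.mem_univ m)
        rcases min_choice (1 - d) (c * Φ (D * ρ ^ n)) with h3 | h3
        · change 1 - min (1 - d) (c * Φ (D * ρ ^ n)) ≤ _
          rw [h3]; linarith
        · change 1 - min (1 - d) (c * Φ (D * ρ ^ n)) ≤ _
          rw [h3]; exact h1
  refine ⟨fun k => renewal ψ w₀ k 0, tendsto_renewal h.d_pos hψ0 hψd hψa hψs hw hwlim,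
    fun k x hx y hy => hmain k 0 x hx y hy ?_⟩
  simpa using hKD x hx y hy

/-- There is a compactly supported probability measure to whose integrals the iterates of bounded
continuous functions converge, uniformly on compact forward invariant sets. -/
theorem exists_limit [ProperSpace S] [BorelSpace S] [T2Space S] [Nonempty S]
    (h : I.Contracting V C ρ d Φ) :
    ∃ (μ : ProbabilityMeasure S) (z : S),
      (∀ K : Set S, IsCompact K → (∀ m, ∀ x ∈ K, I.f m x ∈ K) → z ∈ K →
        (∀ g : S → ℝ, Continuous g → (∃ c, ∀ x, |g x| ≤ c) →
          ∃ b : ℕ → ℝ, Tendsto b atTop (𝓝 0) ∧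
            ∀ k, ∀ x ∈ K, |I.transfer^[k] g x - ∫ y, g y ∂(μ : Measure S)| ≤ b k) ∧
        (μ : Measure S) Kᶜ = 0) := by
  obtain ⟨z⟩ := ‹Nonempty S›
  obtain ⟨δ, hδ⟩ : ∃ δ : ProbabilityMeasure S, (δ : Measure S) = Measure.dirac z :=
    ⟨⟨Measure.dirac z, inferInstance⟩, rfl⟩
  let ν : ℕ → ProbabilityMeasure S := fun k => (MarkovChain.step I.kernel)^[k] δ
  have hνK : ∀ K : Set S, IsCompact K → (∀ m, ∀ x ∈ K, I.f m x ∈ K) → z ∈ K → ∀ k,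
      (ν k : Measure S) Kᶜ = 0 := by
    intro K hKc hK hz k
    induction k with
    | zero =>
      change (δ : Measure S) Kᶜ = 0
      rw [hδ, Measure.dirac_apply' _ hKc.measurableSet.compl]
      simp [hz]
    | succ k ih =>
      change (((MarkovChain.step I.kernel)^[k + 1] δ : ProbabilityMeasure S) : Measure S) Kᶜ = 0
      rw [Function.iterate_succ_apply']
      exact I.step_compl_eq_zero hKc.measurableSet hK ih
  -- Prokhorov's theorem for the tight family of measures with no mass outside `K`.
  have hcomp : ∀ K : Set S, IsCompact K → IsCompact {μ : ProbabilityMeasure S | μ Kᶜ = 0} := by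
    intro K hKc
    have := isCompact_setOfPred_probabilityMeasure_mass_eq_compl_isCompact_le (E := S)
      (u := fun _ => 0) (K := fun _ => K) tendsto_const_nhds (fun _ => hKc)
      (Or.inr monotone_const)
    simpa using this
  have hmem : ∀ K : Set S, IsCompact K → (∀ m, ∀ x ∈ K, I.f m x ∈ K) → z ∈ K → ∀ k,
      ν k ∈ {μ : ProbabilityMeasure S | μ Kᶜ = 0} := fun K hKc hK hz k => by
    change ν k Kᶜ = 0
    rw [ProbabilityMeasure.null_iff_toMeasure_null]
    exact hνK K hKc hK hz k
  obtain ⟨K₀, hK₀c, hK₀, hz, -⟩ := h.exists_invariant_compact z z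
  -- Along an ultrafilter the laws of the chain started at `z` converge without passing to
  -- subsequences. The limit is fixed before `K`, so one measure serves all compact forward
  -- invariant sets containing `z`.
  let U : Ultrafilter ℕ := Ultrafilter.of atTop
  have hU : (U : Filter ℕ) ≤ atTop := Ultrafilter.of_le atTop
  obtain ⟨μ, -, hμ⟩ := (hcomp K₀ hK₀c).ultrafilter_le_nhds (U.map ν) (by
    rw [le_principal_iff]
    exact Eventually.of_forall (f := (U : Filter ℕ)) (hmem K₀ hK₀c hK₀ hz))
  have hlim : Tendsto ν U (𝓝 μ) := hμ
  refine ⟨μ, z, fun K hKc hK hzK => ⟨fun g hg ⟨c, hc⟩ => ?_, ?_⟩⟩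
  · obtain ⟨b, hb, hosc⟩ := h.exists_oscillation_bound hKc hK hg
    refine ⟨b, hb, fun k x hx => ?_⟩
    have hint : Tendsto (fun n => I.transfer^[n] g z) U (𝓝 (∫ y, g y ∂(μ : Measure S))) := by
      have h1 := ProbabilityMeasure.tendsto_iff_forall_integral_tendsto.1 hlim
        (BoundedContinuousFunction.ofNormedAddCommGroup g hg c hc)
      refine h1.congr fun n => ?_
      change ∫ y, g y ∂(ν n : Measure S) = _
      simp only [ν]
      rw [I.integral_step_iterate hg.measurable hc, hδ]
      exact integral_dirac' _ _ (I.measurable_transfer_iterate hg.measurable n).stronglyMeasurable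
    -- For n ≥ k, T^n g z is an average of values of T^k g on `K`, hence within the oscillation `b
    -- k` of T^k g x.
    have hev : ∀ᶠ n in (U : Filter ℕ), |I.transfer^[n] g z - I.transfer^[k] g x| ≤ b k := by
      filter_upwards [(eventually_ge_atTop k).filter_mono hU] with n hn
      obtain ⟨j, rfl⟩ := Nat.exists_eq_add_of_le hn
      rw [add_comm, Function.iterate_add_apply]
      exact I.abs_transfer_iterate_sub_le hK (fun y hy => hosc k y hy x hx) j z hzK
    rw [abs_sub_comm]
    exact le_of_tendsto (hint.sub_const _).abs hev
  · have hcl := (hcomp K hKc).isClosed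
    have : μ ∈ {μ : ProbabilityMeasure S | μ Kᶜ = 0} :=
      hcl.mem_of_tendsto hlim (Eventually.of_forall (hmem K hKc hK hzK))
    change μ Kᶜ = 0 at this
    rwa [ProbabilityMeasure.null_iff_toMeasure_null] at this

end Contracting

end IFS

namespace MarkovChain

/-! ### Ergodicity of a unique invariant measure -/

section Ergodic

variable {S : Type*} [MeasurableSpace S]

/-- A unique invariant probability measure is ergodic: conditioned on an absorbing set of positive
measure it stays invariant. -/
theorem isErgodic_of_unique {P : Kernel S S} [IsMarkovKernel P] {μ : ProbabilityMeasure S}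
    (hμ : IsInvariant P μ) (huniq : ∀ ν : ProbabilityMeasure S, IsInvariant P ν → ν = μ) :
    IsErgodic P μ := by
  refine ⟨hμ, fun A hA habs => ?_⟩
  by_cases h0 : (μ : Measure S) A = 0
  · exact Or.inl h0
  refine Or.inr ?_
  have hinv : ∀ B, MeasurableSet B → ∫⁻ x, P x B ∂(μ : Measure S) = (μ : Measure S) B := by
    intro B hB
    rw [← Measure.bind_apply hB P.measurable.aemeasurable]
    exact congrArg (fun ν : Measure S => ν B) hμ
  have hA1 : ∫⁻ x in A, P x A ∂(μ : Measure S) = (μ : Measure S) A := by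
    rw [setLIntegral_congr_fun_ae hA habs]
    simp
  -- All mass starting in `A` stays there and already accounts for μ(A), so invariance leaves no
  -- mass entering from outside. Hence the restriction of μ to `A` is invariant too.
  have hAc : ∫⁻ x in Aᶜ, P x A ∂(μ : Measure S) = 0 := by
    have h1 := lintegral_add_compl (μ := (μ : Measure S)) (fun x => P x A) hA
    rw [hinv A hA, hA1] at h1
    exact (ENNReal.add_right_inj (measure_ne_top _ A)).1 (h1.trans (add_zero _).symm)
  have hrestr : ∀ B, MeasurableSet B →
      ∫⁻ x in A, P x B ∂(μ : Measure S) = (μ : Measure S) (B ∩ A) := by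
    intro B hB
    have h1 : ∫⁻ x in A, P x B ∂(μ : Measure S) = ∫⁻ x in A, P x (B ∩ A) ∂(μ : Measure S) := by
      refine setLIntegral_congr_fun_ae hA ?_
      filter_upwards [habs] with x hx hxA
      have h2 : P x Aᶜ = 0 := (prob_compl_eq_zero_iff hA).2 (hx hxA)
      rw [← measure_inter_add_sdiff B hA,
        measure_mono_null (show B \ A ⊆ Aᶜ from fun y hy => hy.2) h2, add_zero]
    have h3 : ∫⁻ x in Aᶜ, P x (B ∩ A) ∂(μ : Measure S) = 0 :=
      le_antisymm ((lintegral_mono fun x => measure_mono Set.inter_subset_right).trans hAc.le)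
        (zero_le)
    rw [h1, ← hinv (B ∩ A) (hB.inter hA), ← lintegral_add_compl (μ := (μ : Measure S)) (fun x => P x (B ∩ A)) hA, h3,
      add_zero]
  have : IsProbabilityMeasure (cond (μ : Measure S) A) := cond_isProbabilityMeasure h0
  have hcond : IsInvariant P ⟨cond (μ : Measure S) A, this⟩ := by
    change (cond (μ : Measure S) A).bind P = cond (μ : Measure S) A
    ext B hB
    rw [Measure.bind_apply hB P.measurable.aemeasurable, ProbabilityTheory.cond,
      lintegral_smul_measure, hrestr B hB, Measure.smul_apply, Measure.restrict_apply hB]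
  have heq := congrArg (fun ν : ProbabilityMeasure S => (ν : Measure S) A) (huniq _ hcond)
  change cond (μ : Measure S) A A = (μ : Measure S) A at heq
  rw [← heq]
  exact cond_apply_self h0 (measure_ne_top _ _)

end Ergodic

/-! ### Sample paths -/

section Path

variable {S : Type*} [MeasurableSpace S] (P : Kernel S S) [IsMarkovKernel P] (x₀ : S)

instance : IsProbabilityMeasure (pathLaw P x₀) := by
  unfold pathLaw; infer_instance

/-- The Markov property: the joint law of the path up to time `n` and of the next state. -/
theorem map_pathLaw_succ (n : ℕ) :
    (pathLaw P x₀).map (fun X => (Preorder.frestrictLe (π := fun _ => S) n X, X (n + 1))) =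
      (pathLaw P x₀).map (Preorder.frestrictLe (π := fun _ => S) n) ⊗ₘ
        (P.comap (fun h : (i : Finset.Iic n) → S => h ⟨n, Finset.mem_Iic.2 le_rfl⟩)
          (measurable_pi_apply _)) :=
  (Kernel.map_frestrictLe_trajMeasure_compProd_eq_map_trajMeasure (X := fun _ => S)).symm

theorem ae_pathLaw_zero {K : Set S} (hK : MeasurableSet K) (hx : x₀ ∈ K) :
    ∀ᵐ X ∂(pathLaw P x₀), X 0 ∈ K := by
  have hmap : (pathLaw P x₀).map (Preorder.frestrictLe (π := fun _ => S) 0) =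
      (Measure.dirac x₀).map
        (MeasurableEquiv.piUnique (fun _ : Finset.Iic 0 => S)).symm := by
    rw [pathLaw, Kernel.trajMeasure, Measure.map_comp _ _ (by fun_prop),
      Kernel.traj_map_frestrictLe, Kernel.partialTraj_self, Measure.id_comp]
  have h1 : ∀ᵐ y ∂((pathLaw P x₀).map (Preorder.frestrictLe (π := fun _ => S) 0)),
      y ⟨0, Finset.mem_Iic.2 le_rfl⟩ ∈ K := by
    rw [hmap, ae_map_iff (by fun_prop) (measurable_pi_apply _ hK), ae_dirac_iff ?_]
    · exact hx
    · exact ((measurable_pi_apply _).comp (MeasurableEquiv.measurable _)) hK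
  exact ae_of_ae_map (f := Preorder.frestrictLe (π := fun _ => S) 0)
    (Preorder.measurable_frestrictLe 0).aemeasurable h1

theorem ae_pathLaw_mem {K : Set S} (hK : MeasurableSet K) (hx : x₀ ∈ K)
    (hP : ∀ x ∈ K, P x Kᶜ = 0) : ∀ᵐ X ∂(pathLaw P x₀), ∀ n, X n ∈ K := by
  refine ae_all_iff.2 fun n => ?_
  induction n with
  | zero => exact ae_pathLaw_zero P x₀ hK hx
  | succ n ih =>
    have hmeas : Measurable fun X : ℕ → S =>
        (Preorder.frestrictLe (π := fun _ => S) n X, X (n + 1)) := by fun_prop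
    have h1 : ∀ᵐ z ∂((pathLaw P x₀).map
        (fun X => (Preorder.frestrictLe (π := fun _ => S) n X, X (n + 1)))), z.2 ∈ K := by
      have h2 : ∀ᵐ y ∂((pathLaw P x₀).map (Preorder.frestrictLe (π := fun _ => S) n)),
          y ⟨n, Finset.mem_Iic.2 le_rfl⟩ ∈ K :=
        (ae_map_iff (by fun_prop) (measurable_pi_apply _ hK)).2 ih
      rw [map_pathLaw_succ, Measure.ae_compProd_iff (measurable_snd hK)]
      filter_upwards [h2] with y hy
      exact hP _ hy
    exact ae_of_ae_map hmeas.aemeasurable h1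

/-- Given the path up to time n, the increment has mean zero under the kernel, so it is orthogonal
to every bounded measurable function of that path. -/
theorem integral_pathLaw_mul_sub {n : ℕ} {u : ((i : Finset.Iic n) → S) → ℝ} (hu : Measurable u)
    {a : ℝ} (ha : ∀ y, |u y| ≤ a) {h : S → ℝ} (hh : Measurable h) {c : ℝ} (hc : ∀ x, |h x| ≤ c) :
    ∫ X, u (Preorder.frestrictLe (π := fun _ => S) n X) * (h (X (n + 1)) - ∫ y, h y ∂(P (X n)))
      ∂(pathLaw P x₀) = 0 := by
  have hPh : Measurable fun x => ∫ y, h y ∂(P x) :=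
    (hh.stronglyMeasurable.integral_kernel (κ := P)).measurable
  have hPc : ∀ x, |∫ y, h y ∂(P x)| ≤ c := fun x => by
    simpa using norm_integral_le_of_norm_le_const (μ := P x) (f := h) (C := c) (ae_of_all _ hc)
  let φ : ((i : Finset.Iic n) → S) × S → ℝ := fun z =>
    u z.1 * (h z.2 - ∫ y, h y ∂(P (z.1 ⟨n, Finset.mem_Iic.2 le_rfl⟩)))
  have hφ : Measurable φ := by
    refine (hu.comp measurable_fst).mul ((hh.comp measurable_snd).sub ?_)
    exact hPh.comp ((measurable_pi_apply _).comp measurable_fst)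
  have hφb : ∀ z, ‖φ z‖ ≤ a * (c + c) := fun z => by
    rw [Real.norm_eq_abs, abs_mul]
    exact mul_le_mul (ha _) ((abs_sub _ _).trans (add_le_add (hc _) (hPc _))) (abs_nonneg _)
      ((abs_nonneg _).trans (ha z.1))
  have hmeas : Measurable fun X : ℕ → S =>
      (Preorder.frestrictLe (π := fun _ => S) n X, X (n + 1)) := by fun_prop
  change ∫ X, φ (Preorder.frestrictLe (π := fun _ => S) n X, X (n + 1)) ∂(pathLaw P x₀) = 0
  have hpm := Measure.isProbabilityMeasure_map (μ := pathLaw P x₀) hmeas.aemeasurable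
  rw [← integral_map (φ := fun X : ℕ → S => (Preorder.frestrictLe (π := fun _ => S) n X, X (n + 1)))
    hmeas.aemeasurable hφ.aestronglyMeasurable]
  rw [map_pathLaw_succ] at hpm ⊢
  rw [Measure.integral_compProd (Integrable.of_bound hφ.aestronglyMeasurable _ (ae_of_all _ hφb))]
  refine integral_eq_zero_of_ae (ae_of_all _ fun y => ?_)
  change ∫ b, u y * (h b - ∫ y, h y ∂(P (y ⟨n, Finset.mem_Iic.2 le_rfl⟩)))
    ∂(P (y ⟨n, Finset.mem_Iic.2 le_rfl⟩)) = 0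
  rw [integral_const_mul, integral_sub (Integrable.of_bound hh.aestronglyMeasurable c
    (ae_of_all _ hc)) (integrable_const _)]
  simp

/-- The sum of the martingale differences `h (X (s + 1)) - (P h) (X s)` up to time `n`. -/
noncomputable def noise (h : S → ℝ) (n : ℕ) (X : ℕ → S) : ℝ :=
  ∑ s ∈ Finset.range n, (h (X (s + 1)) - ∫ y, h y ∂(P (X s)))

theorem abs_increment_le {h : S → ℝ} {c : ℝ} (hc : ∀ x, |h x| ≤ c) (x x' : S) :
    |h x' - ∫ y, h y ∂(P x)| ≤ 2 * c := by
  have hPc : |∫ y, h y ∂(P x)| ≤ c := by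
    simpa using norm_integral_le_of_norm_le_const (μ := P x) (f := h) (C := c) (ae_of_all _ hc)
  rw [two_mul]
  exact (abs_sub _ _).trans (add_le_add (hc _) hPc)

omit [IsMarkovKernel P] in
theorem measurable_increment {h : S → ℝ} (hh : Measurable h) (s : ℕ) :
    Measurable fun X : ℕ → S => h (X (s + 1)) - ∫ y, h y ∂(P (X s)) := by
  have hPh : Measurable fun x => ∫ y, h y ∂(P x) :=
    (hh.stronglyMeasurable.integral_kernel (κ := P)).measurable
  exact (hh.comp (measurable_pi_apply _)).sub (hPh.comp (measurable_pi_apply _))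

omit [IsMarkovKernel P] in
theorem measurable_noise {h : S → ℝ} (hh : Measurable h) (n : ℕ) : Measurable (noise P h n) :=
  Finset.measurable_sum _ fun s _ => measurable_increment P hh s

theorem abs_noise_le {h : S → ℝ} {c : ℝ} (hc : ∀ x, |h x| ≤ c) (n : ℕ) (X : ℕ → S) :
    |noise P h n X| ≤ n * (2 * c) := by
  refine (Finset.abs_sum_le_sum_abs _ _).trans ?_
  refine (Finset.sum_le_sum fun s _ => abs_increment_le P hc (X s) (X (s + 1))).trans ?_
  simp

theorem integral_noise_mul_increment {h : S → ℝ} (hh : Measurable h) {c : ℝ}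
    (hc : ∀ x, |h x| ≤ c) (n : ℕ) :
    ∫ X, noise P h n X * (h (X (n + 1)) - ∫ y, h y ∂(P (X n))) ∂(pathLaw P x₀) = 0 := by
  let u : ((i : Finset.Iic n) → S) → ℝ := fun y => ∑ s : Fin n,
    (h (y ⟨s + 1, Finset.mem_Iic.2 s.2⟩) - ∫ z, h z ∂(P (y ⟨s, Finset.mem_Iic.2 s.2.le⟩)))
  have hPh : Measurable fun x => ∫ y, h y ∂(P x) :=
    (hh.stronglyMeasurable.integral_kernel (κ := P)).measurable
  have hu : Measurable u := Finset.measurable_sum _ fun s _ =>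
    (hh.comp (measurable_pi_apply _)).sub (hPh.comp (measurable_pi_apply _))
  have hub : ∀ y, |u y| ≤ n * (2 * c) := fun y => by
    refine (Finset.abs_sum_le_sum_abs _ _).trans ?_
    refine (Finset.sum_le_sum fun s _ => abs_increment_le P hc _ _).trans ?_
    simp
  rw [← integral_pathLaw_mul_sub P x₀ hu hub hh hc]
  refine integral_congr_ae (ae_of_all _ fun X => ?_)
  change noise P h n X * _ = u _ * _
  rw [noise, Finset.sum_range]
  rfl

/-- Increments are orthogonal to the past, so second moments add up: the growth is linear in n, not
quadratic. -/
theorem integral_noise_sq_le {h : S → ℝ} (hh : Measurable h) {c : ℝ} (hc : ∀ x, |h x| ≤ c)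
    (n : ℕ) : ∫ X, noise P h n X ^ 2 ∂(pathLaw P x₀) ≤ n * (2 * c) ^ 2 := by
  induction n with
  | zero => simp [noise]
  | succ n ih =>
    let D : (ℕ → S) → ℝ := fun X => h (X (n + 1)) - ∫ y, h y ∂(P (X n))
    have hD : Measurable D := measurable_increment P hh n
    have hDb : ∀ X, |D X| ≤ 2 * c := fun X => abs_increment_le P hc _ _
    have hN := measurable_noise P hh n
    have hNb := abs_noise_le P hc n
    have i1 : Integrable (fun X => noise P h n X ^ 2) (pathLaw P x₀) :=
      Integrable.of_bound (hN.pow_const 2).aestronglyMeasurable ((n * (2 * c)) ^ 2)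
        (ae_of_all _ fun X => by
          rw [Real.norm_eq_abs, abs_pow]
          exact pow_le_pow_left₀ (abs_nonneg _) (hNb X) 2)
    have i2 : Integrable (fun X => noise P h n X * D X) (pathLaw P x₀) :=
      Integrable.of_bound (hN.mul hD).aestronglyMeasurable (n * (2 * c) * (2 * c))
        (ae_of_all _ fun X => by
          rw [Real.norm_eq_abs, abs_mul]
          exact mul_le_mul (hNb X) (hDb X) (abs_nonneg _) ((abs_nonneg _).trans (hNb X)))
    have hD2 : ∀ X, D X ^ 2 ≤ (2 * c) ^ 2 := fun X => by
      rw [← sq_abs]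
      exact pow_le_pow_left₀ (abs_nonneg _) (hDb X) 2
    have i3 : Integrable (fun X => D X ^ 2) (pathLaw P x₀) :=
      Integrable.of_bound (hD.pow_const 2).aestronglyMeasurable ((2 * c) ^ 2)
        (ae_of_all _ fun X => by
          rw [Real.norm_eq_abs, abs_of_nonneg (sq_nonneg _)]
          exact hD2 X)
    have e : ∀ X, noise P h (n + 1) X ^ 2 =
        noise P h n X ^ 2 + 2 * (noise P h n X * D X) + D X ^ 2 := fun X => by
      rw [noise, Finset.sum_range_succ]
      change (noise P h n X + D X) ^ 2 = _
      ring
    have i12 : Integrable (fun X => noise P h n X ^ 2 + 2 * (noise P h n X * D X)) (pathLaw P x₀) :=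
      i1.add (i2.const_mul 2)
    simp only [e]
    rw [integral_add i12 i3, integral_add i1 (i2.const_mul 2),
      integral_const_mul, integral_noise_mul_increment P x₀ hh hc n]
    have h3 : ∫ X, D X ^ 2 ∂(pathLaw P x₀) ≤ (2 * c) ^ 2 := by
      simpa using integral_mono i3 (integrable_const ((2 * c) ^ 2)) hD2
    push_cast
    linarith

/-- The strong law of large numbers for the martingale differences of a bounded function. -/
theorem ae_tendsto_noise_div {h : S → ℝ} (hh : Measurable h) {c : ℝ} (hc : ∀ x, |h x| ≤ c) :
    ∀ᵐ X ∂(pathLaw P x₀), Tendsto (fun n : ℕ => noise P h n X / n) atTop (𝓝 0) := by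
  -- Along the times n² the second moment of noise over time is at most (2c)² / n², which is
  -- summable, so almost surely the squares have a finite sum.
  let F : ℕ → (ℕ → S) → ℝ≥0∞ := fun n X => ENNReal.ofReal ((noise P h (n ^ 2) X / (n ^ 2 : ℕ)) ^ 2)
  have hF : ∀ n, Measurable (F n) := fun n =>
    (((measurable_noise P hh _).div_const _).pow_const 2).ennreal_ofReal
  have hFint : ∀ n, ∫⁻ X, F n X ∂(pathLaw P x₀) ≤
      ENNReal.ofReal ((2 * c) ^ 2 * (1 / (n : ℝ) ^ 2)) := by
    intro n
    rw [← ofReal_integral_eq_lintegral_ofReal]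
    · refine ENNReal.ofReal_le_ofReal ?_
      simp only [div_pow]
      rw [integral_div]
      rcases Nat.eq_zero_or_pos n with rfl | hn
      · simp
      have hn' : (0 : ℝ) < n := by exact_mod_cast hn
      rw [div_le_iff₀ (by positivity)]
      refine (integral_noise_sq_le P x₀ hh hc (n ^ 2)).trans (le_of_eq ?_)
      push_cast
      field_simp
    · refine Integrable.of_bound
        (((measurable_noise P hh _).div_const _).pow_const 2).aestronglyMeasurable ((2 * c) ^ 2)
        (ae_of_all _ fun X => ?_)
      rw [Real.norm_eq_abs, abs_pow, abs_div, Nat.abs_cast]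
      refine pow_le_pow_left₀ (by positivity) (div_le_of_le_mul₀ (Nat.cast_nonneg _) ?_ ?_) 2
      · exact (abs_nonneg _).trans (abs_increment_le P hc (X 0) (X 0))
      · rw [mul_comm]; exact abs_noise_le P hc _ X
    · exact ae_of_all _ fun X => sq_nonneg _
  have hsum : ∫⁻ X, ∑' n, F n X ∂(pathLaw P x₀) ≠ ∞ := by
    rw [lintegral_tsum fun n => (hF n).aemeasurable]
    have hs : Summable fun n : ℕ => (2 * c) ^ 2 * (1 / (n : ℝ) ^ 2) :=
      (Real.summable_one_div_nat_pow.2 one_lt_two).mul_left _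
    refine ne_top_of_le_ne_top ?_ (ENNReal.tsum_le_tsum hFint)
    rw [← ENNReal.ofReal_tsum_of_nonneg (fun n => by positivity) hs]
    exact ENNReal.ofReal_ne_top
  filter_upwards [ae_lt_top (Measurable.tsum hF) hsum] with X hX
  have hsq : Tendsto (fun n : ℕ => (noise P h (n ^ 2) X / (n ^ 2 : ℕ)) ^ 2) atTop (𝓝 0) := by
    have h1 := (ENNReal.tendsto_toReal ENNReal.zero_ne_top).comp
      (ENNReal.tendsto_atTop_zero_of_tsum_ne_top hX.ne)
    refine h1.congr fun n => ?_
    exact ENNReal.toReal_ofReal (sq_nonneg _)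
  have hsub : Tendsto (fun n : ℕ => noise P h (n ^ 2) X / (n ^ 2 : ℕ)) atTop (𝓝 0) := by
    have h1 := (Real.continuous_sqrt.tendsto 0).comp hsq
    rw [Real.sqrt_zero] at h1
    refine (tendsto_zero_iff_abs_tendsto_zero _).2 (h1.congr fun n => ?_)
    exact Real.sqrt_sq_eq_abs _
  -- The drift 2c per step makes the sequence monotone. As consecutive squares have ratio tending to
  -- 1, convergence of v n / n along squares then fills the gaps.
  let v : ℕ → ℝ := fun n => noise P h n X + n * (2 * c)
  have hmono : Monotone v := monotone_nat_of_le_succ fun n => by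
    have h1 := (abs_le.1 (abs_increment_le P hc (X n) (X (n + 1)))).1
    simp only [v, noise, Finset.sum_range_succ]
    push_cast
    linarith
  have hdiv : ∀ n : ℕ, n ≠ 0 → v n / n = noise P h n X / n + 2 * c := fun n hn => by
    have : (n : ℝ) ≠ 0 := by exact_mod_cast hn
    simp only [v]
    field_simp
  have hv : Tendsto (fun n : ℕ => v n / n) atTop (𝓝 (2 * c)) := by
    refine tendsto_div_of_monotone_of_exists_subseq_tendsto_div v _ hmono fun a ha => ?_
    refine ⟨fun n => n ^ 2, ?_, tendsto_pow_atTop two_ne_zero, ?_⟩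
    · have hlim : Tendsto (fun n : ℕ => (1 + 1 / (n : ℝ)) ^ 2) atTop (𝓝 1) := by
        have := (tendsto_one_div_atTop_nhds_zero_nat (𝕜 := ℝ)).const_add 1 |>.pow 2
        simpa using this
      filter_upwards [hlim.eventually (gt_mem_nhds ha), eventually_gt_atTop 0] with n hn hn0
      have hn' : (0 : ℝ) < n := by exact_mod_cast hn0
      have e : (((n + 1) ^ 2 : ℕ) : ℝ) = (1 + 1 / (n : ℝ)) ^ 2 * ((n ^ 2 : ℕ) : ℝ) := by
        push_cast
        field_simp
      rw [e]
      exact mul_le_mul_of_nonneg_right hn.le (Nat.cast_nonneg _)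
    · have h1 := hsub.add_const (2 * c)
      rw [zero_add] at h1
      refine h1.congr' ?_
      filter_upwards [eventually_gt_atTop 0] with n hn
      exact (hdiv _ (pow_pos hn 2).ne').symm
  have h2 := hv.sub_const (2 * c)
  rw [sub_self] at h2
  refine h2.congr' ?_
  filter_upwards [eventually_gt_atTop 0] with n hn
  rw [hdiv n hn.ne', add_sub_cancel_right]

end Path

end MarkovChain

namespace IFS.Contracting

/-! ### Unique ergodicity of contracting systems -/

variable {S : Type*} [MeasurableSpace S] [PseudoMetricSpace S] [BorelSpace S]
  {M : Type*} [Fintype M] {I : IFS S M} {V : S → S → ℝ} {C ρ d : ℝ} {Φ : ℝ → ℝ}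

/-- Summation of the martingale differences of T^k g shows that the time averages of T^k g and
T^(k+1) g have vanishing difference. Hence g may be replaced by T^k g for any fixed k, and on `K`,
which the path never leaves, T^k g is within `b k` of `L`. -/
theorem ae_tendsto_average (h : I.Contracting V C ρ d Φ) {K : Set S} (hKm : MeasurableSet K)
    (hK : ∀ m, ∀ x ∈ K, I.f m x ∈ K) {g : S → ℝ} (hg : Continuous g) {c : ℝ}
    (hc : ∀ x, |g x| ≤ c) {L : ℝ} {b : ℕ → ℝ} (hb : Tendsto b atTop (𝓝 0))
    (hL : ∀ k, ∀ x ∈ K, |I.transfer^[k] g x - L| ≤ b k) {x₀ : S} (hx₀ : x₀ ∈ K) :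
    ∀ᵐ X ∂(MarkovChain.pathLaw I.kernel x₀),
      Tendsto (fun n : ℕ => (∑ s ∈ Finset.range n, g (X s)) / n) atTop (𝓝 L) := by
  have hmeas := fun k => (h.continuous_transfer_iterate hg k).measurable
  have hbd := fun k => I.abs_transfer_iterate_le hc k
  have hnoise := ae_all_iff.2 fun k =>
    MarkovChain.ae_tendsto_noise_div I.kernel x₀ (hmeas k) (hbd k)
  have hmem := MarkovChain.ae_pathLaw_mem I.kernel x₀ hKm hx₀
    fun x hx => I.kernel_compl_eq_zero hKm hK hx
  filter_upwards [hnoise, hmem] with X hX hXK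
  let A : ℕ → ℕ → ℝ := fun k n => ∑ s ∈ Finset.range n, I.transfer^[k] g (X s)
  have hstep : ∀ k, Tendsto (fun n : ℕ => A k n / n - A (k + 1) n / n) atTop (𝓝 0) := by
    intro k
    have h1 : Tendsto (fun n : ℕ => (I.transfer^[k] g (X n) - I.transfer^[k] g (X 0)) / n) atTop
        (𝓝 0) := by
      refine squeeze_zero_norm (a := fun n : ℕ => (c + c) / n) (fun n => ?_)
        (tendsto_const_div_atTop_nhds_zero_nat (c + c))
      rw [Real.norm_eq_abs, abs_div, Nat.abs_cast]
      exact div_le_div_of_nonneg_right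
        ((abs_sub _ _).trans (add_le_add (hbd k _) (hbd k _))) (Nat.cast_nonneg n)
    have h2 := (hX k).sub h1
    rw [sub_zero] at h2
    refine h2.congr fun n => ?_
    -- Shifting the sum of T^k g (X (s + 1)) back by one costs the two boundary terms, which are
    -- bounded and vanish after division by n.
    have e : MarkovChain.noise I.kernel (I.transfer^[k] g) n X =
        A k n + (I.transfer^[k] g (X n) - I.transfer^[k] g (X 0)) - A (k + 1) n := by
      simp only [MarkovChain.noise, A, I.integral_kernel (hmeas k), Finset.sum_sub_distrib,
        Function.iterate_succ_apply']
      rw [← Finset.sum_range_sub (fun s => I.transfer^[k] g (X s)), Finset.sum_sub_distrib]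
      ring
    rw [e]
    ring
  have hall : ∀ k, Tendsto (fun n : ℕ => A 0 n / n - A k n / n) atTop (𝓝 0) := by
    intro k
    induction k with
    | zero => simp
    | succ k ih =>
      have := ih.add (hstep k)
      simpa using this
  have hclose : ∀ k n, 0 < n → |A k n / n - L| ≤ b k := by
    intro k n hn
    have hn' : (0 : ℝ) < n := by exact_mod_cast hn
    have e : A k n / n - L = (∑ s ∈ Finset.range n, (I.transfer^[k] g (X s) - L)) / n := by
      simp only [A, Finset.sum_sub_distrib, Finset.sum_const, Finset.card_range, nsmul_eq_mul]
      field_simp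
    rw [e, abs_div, Nat.abs_cast, div_le_iff₀ hn']
    refine (Finset.abs_sum_le_sum_abs _ _).trans ?_
    refine (Finset.sum_le_sum fun s _ => hL k _ (hXK s)).trans ?_
    simp [mul_comm]
  rw [Metric.tendsto_atTop]
  intro ε hε
  obtain ⟨k, hk⟩ := (hb.eventually (gt_mem_nhds (half_pos hε))).exists
  obtain ⟨n₀, hn₀⟩ := Metric.tendsto_atTop.1 (hall k) (ε / 2) (half_pos hε)
  refine ⟨n₀ + 1, fun n hn => ?_⟩
  have h1 := hn₀ n (by omega)
  have h2 := hclose k n (by omega)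
  rw [Real.dist_eq, sub_zero] at h1
  rw [Real.dist_eq]
  change |A 0 n / n - L| < ε
  calc |A 0 n / n - L| = |(A 0 n / n - A k n / n) + (A k n / n - L)| := by ring_nf
    _ ≤ |A 0 n / n - A k n / n| + |A k n / n - L| := abs_add_le _ _
    _ < ε := by linarith

variable [ProperSpace S] [T2Space S] [Nonempty S]

/-- A contracting iterated function system with Dini continuous probabilities that are bounded below
is uniquely ergodic. -/
theorem uniquelyErgodic (h : I.Contracting V C ρ d Φ) :
    MarkovChain.UniquelyErgodic I.kernel := by
  obtain ⟨μ, z, hμ⟩ := h.exists_limit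
  have hpt : ∀ g : S → ℝ, Continuous g → (∃ c, ∀ x, |g x| ≤ c) → ∀ x,
      Tendsto (fun k => I.transfer^[k] g x) atTop (𝓝 (∫ y, g y ∂(μ : Measure S))) := by
    intro g hg hc x
    obtain ⟨K, hKc, hK, hxK, hzK⟩ := h.exists_invariant_compact x z
    obtain ⟨b, hb, hbound⟩ := (hμ K hKc hK hzK).1 g hg hc
    rw [tendsto_iff_dist_tendsto_zero]
    exact squeeze_zero (fun k => dist_nonneg) (fun k => hbound k x hxK) hb
  have hattr : MarkovChain.IsAttractive I.kernel μ := by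
    intro ν
    rw [ProbabilityMeasure.tendsto_iff_forall_integral_tendsto]
    intro g
    have hgb : ∀ x, |g x| ≤ ‖g‖ := fun x => g.norm_coe_le_norm x
    simp only [I.integral_step_iterate g.continuous.measurable hgb]
    have hlim := tendsto_integral_of_dominated_convergence (μ := (ν : Measure S))
      (F := fun k => I.transfer^[k] g) (f := fun _ => ∫ y, g y ∂(μ : Measure S)) (fun _ => ‖g‖)
      (fun k => (I.measurable_transfer_iterate g.continuous.measurable k).aestronglyMeasurable)
      (integrable_const _)
      (fun k => ae_of_all _ fun x => I.abs_transfer_iterate_le hgb k x)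
      (ae_of_all _ fun x => hpt g g.continuous ⟨‖g‖, hgb⟩ x)
    simpa using hlim
  -- The sequence T^k (T g) z tends to ∫ T g dμ, and as T^(k+1) g z it also tends to ∫ g dμ.
  have hinv : MarkovChain.IsInvariant I.kernel μ := by
    change (μ : Measure S).bind I.kernel = μ
    refine ext_of_forall_integral_eq_of_IsFiniteMeasure fun g => ?_
    have hgb : ∀ x, |g x| ≤ ‖g‖ := fun x => g.norm_coe_le_norm x
    have h1 := I.integral_step g.continuous.measurable hgb μ
    change ∫ x, g x ∂((μ : Measure S).bind I.kernel) = _ at h1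
    rw [h1]
    have h2 := hpt _ (h.continuous_transfer g.continuous)
      ⟨‖g‖, fun x => I.abs_transfer_iterate_le hgb 1 x⟩ z
    have h3 := (tendsto_add_atTop_iff_nat 1).2 (hpt g g.continuous ⟨‖g‖, hgb⟩ z)
    exact tendsto_nhds_unique h2 h3
  have huniq : ∀ ν : ProbabilityMeasure S, MarkovChain.IsInvariant I.kernel ν → ν = μ := by
    intro ν hν
    have hfix : MarkovChain.step I.kernel ν = ν := Subtype.ext hν
    have h1 := hattr ν
    simp only [Function.iterate_fixed hfix] at h1
    exact tendsto_nhds_unique tendsto_const_nhds h1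
  refine ⟨μ, hinv, hattr, huniq, MarkovChain.isErgodic_of_unique hinv huniq, fun g hg => ?_⟩
  -- On a compact set that carries everything, `g` agrees with a bounded continuous function.
  have htrunc : ∀ x₀, ∃ (K : Set S) (g' : S → ℝ) (c : ℝ), IsCompact K ∧
      (∀ m, ∀ x ∈ K, I.f m x ∈ K) ∧ x₀ ∈ K ∧ z ∈ K ∧ Continuous g' ∧ (∀ x, |g' x| ≤ c) ∧
      ∀ x ∈ K, g' x = g x := by
    intro x₀
    obtain ⟨K, hKc, hK, hx₀K, hzK⟩ := h.exists_invariant_compact x₀ z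
    obtain ⟨c, hc⟩ := hKc.exists_bound_of_continuousOn hg.continuousOn
    have hc0 : 0 ≤ c := (norm_nonneg _).trans (hc z hzK)
    refine ⟨K, fun x => max (-c) (min c (g x)), c, hKc, hK, hx₀K, hzK, by fun_prop,
      fun x => ?_, fun x hx => ?_⟩
    · exact abs_le.2 ⟨le_max_left _ _, max_le (by linarith) (min_le_left _ _)⟩
    · have := abs_le.1 (hc x hx)
      change max (-c) (min c (g x)) = g x
      rw [min_eq_right this.2, max_eq_right this.1]
  have hae : ∀ (K : Set S) (g' : S → ℝ), (μ : Measure S) Kᶜ = 0 → (∀ x ∈ K, g' x = g x) →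
      g' =ᵐ[(μ : Measure S)] g := by
    intro K g' hK0 hgg'
    filter_upwards [measure_eq_zero_iff_ae_notMem.1 hK0] with x hx
    exact hgg' x (not_not.1 hx)
  refine ⟨?_, fun x₀ => ?_⟩
  · obtain ⟨K, g', c, hKc, hK, -, hzK, hg', hc, hgg'⟩ := htrunc z
    exact (Integrable.of_bound hg'.aestronglyMeasurable c (ae_of_all _ hc)).congr
      (hae K g' (hμ K hKc hK hzK).2 hgg')
  · obtain ⟨K, g', c, hKc, hK, hx₀K, hzK, hg', hc, hgg'⟩ := htrunc x₀
    obtain ⟨b, hb, hbound⟩ := (hμ K hKc hK hzK).1 g' hg' ⟨c, hc⟩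
    have havg := h.ae_tendsto_average hKc.measurableSet hK hg' hc hb hbound hx₀K
    have hmem := MarkovChain.ae_pathLaw_mem I.kernel x₀ hKc.measurableSet hx₀K
      fun x hx => I.kernel_compl_eq_zero hKc.measurableSet hK hx
    filter_upwards [havg, hmem] with X hX hXK
    rw [integral_congr_ae (hae K g' (hμ K hKc hK hzK).2 hgg')] at hX
    refine ((tendsto_add_atTop_iff_nat 1).2 hX).congr fun k => ?_
    rw [Finset.sum_congr rfl fun s _ => hgg' (X s) (hXK s)]
    push_cast
    rfl

end IFS.Contracting

theorem MarkovChain.UniquelyErgodic.hasUniqueAttractiveInvariantMeasure {S : Type*}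
    [MeasurableSpace S] [TopologicalSpace S] [OpensMeasurableSpace S] {P : Kernel S S}
    [IsMarkovKernel P] (h : MarkovChain.UniquelyErgodic P) :
    MarkovChain.HasUniqueAttractiveInvariantMeasure P := by
  obtain ⟨μ, h1, h2, h3, -⟩ := h
  exact ⟨μ, h1, h2, h3⟩

/-! ### The feedback loop -/

theorem Finset.abs_prod_sub_prod_le {ι : Type*} (s : Finset ι) {a b : ι → ℝ}
    (ha : ∀ i, 0 ≤ a i ∧ a i ≤ 1) (hb : ∀ i, 0 ≤ b i ∧ b i ≤ 1) :
    |∏ i ∈ s, a i - ∏ i ∈ s, b i| ≤ ∑ i ∈ s, |a i - b i| := by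
  classical
  induction s using Finset.induction_on with
  | empty => simp
  | insert i s hi ih =>
    rw [Finset.prod_insert hi, Finset.prod_insert hi, Finset.sum_insert hi]
    have hA0 : 0 ≤ ∏ i ∈ s, a i := Finset.prod_nonneg fun i _ => (ha i).1
    have hA1 : ∏ i ∈ s, a i ≤ 1 := Finset.prod_le_one (fun i _ => (ha i).1) fun i _ => (ha i).2
    have e : a i * ∏ i ∈ s, a i - b i * ∏ i ∈ s, b i =
        (a i - b i) * ∏ i ∈ s, a i + b i * (∏ i ∈ s, a i - ∏ i ∈ s, b i) := by ring
    rw [e]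
    refine (abs_add_le _ _).trans (add_le_add ?_ ?_)
    · rw [abs_mul, abs_of_nonneg hA0]
      exact mul_le_of_le_one_right (abs_nonneg _) hA1
    · rw [abs_mul, abs_of_nonneg (hb i).1]
      exact (mul_le_of_le_one_left (abs_nonneg _) (hb i).2).trans ih

theorem abs_mul_sub_mul_le_of_mem_unitInterval {a b a' b' : ℝ} (ha : 0 ≤ a ∧ a ≤ 1)
    (hb' : 0 ≤ b' ∧ b' ≤ 1) : |b * a - b' * a'| ≤ |b - b'| + |a - a'| := by
  have e : b * a - b' * a' = (b - b') * a + b' * (a - a') := by ring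
  rw [e]
  refine (abs_add_le _ _).trans (add_le_add ?_ ?_)
  · rw [abs_mul, abs_of_nonneg ha.1]
    exact mul_le_of_le_one_right (abs_nonneg _) ha.2
  · rw [abs_mul, abs_of_nonneg hb'.1]
    exact mul_le_of_le_one_left (abs_nonneg _) hb'.2

theorem abs_dotProduct_le {n : ℕ} (c x : Fin n → ℝ) : |c ⬝ᵥ x| ≤ (∑ i, |c i|) * ‖x‖ := by
  rw [dotProduct, Finset.sum_mul]
  refine (Finset.abs_sum_le_sum_abs _ _).trans (Finset.sum_le_sum fun i _ => ?_)
  rw [abs_mul]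
  exact mul_le_mul_of_nonneg_left (norm_le_pi_norm x i) (abs_nonneg _)

theorem LinearFilter.abs_out_sub_le (F : LinearFilter) (x y : Fin F.n → ℝ) :
    |F.out x - F.out y| ≤ (∑ i, |F.C i|) * ‖x - y‖ := by
  rw [LinearFilter.out, LinearFilter.out, ← dotProduct_sub]
  exact abs_dotProduct_le _ _

theorem LinearFilter.next_sub_next (F : LinearFilter) (x x' : Fin F.n → ℝ) (y y' : ℝ) :
    F.next x y - F.next x' y' = F.A.mulVec (x - x') + (y - y') • F.B := by
  rw [LinearFilter.next, LinearFilter.next, Matrix.mulVec_sub, sub_smul]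
  abel

theorem LinearController.abs_out_sub_le (K : LinearController) (x y : Fin K.n → ℝ) (e e' : ℝ) :
    |K.out x e - K.out y e'| ≤ (∑ i, |K.C i|) * ‖x - y‖ + |K.D| * |e - e'| := by
  have h : K.out x e - K.out y e' = K.C ⬝ᵥ (x - y) + K.D * (e - e') := by
    rw [LinearController.out, LinearController.out, dotProduct_sub]
    ring
  rw [h, ← abs_mul]
  exact (abs_add_le _ _).trans (add_le_add (abs_dotProduct_le _ _) le_rfl)

theorem LinearController.next_sub_next (K : LinearController) (x x' : Fin K.n → ℝ) (e e' : ℝ) :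
    K.next x e - K.next x' e' = K.A.mulVec (x - x') + (e - e') • K.B := by
  rw [LinearController.next, LinearController.next, Matrix.mulVec_sub, sub_smul]
  abel

theorem IsClosed.properSpace_subtype {E : Type*} [PseudoMetricSpace E] [ProperSpace E] {X : Set E}
    (hX : IsClosed X) : ProperSpace X where
  isCompact_closedBall x r := by
    rw [hX.isClosedEmbedding_subtypeVal.isEmbedding.isCompact_iff]
    have e : (Subtype.val '' Metric.closedBall x r : Set E) = Metric.closedBall (x : E) r ∩ X := by
      ext y
      simp only [Set.mem_image, Metric.mem_closedBall, Set.mem_inter_iff, Subtype.exists]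
      constructor
      · rintro ⟨y, hy, hd, rfl⟩; exact ⟨hd, hy⟩
      · rintro ⟨hd, hy⟩; exact ⟨y, hy, hd, rfl⟩
    rw [e]
    exact (isCompact_closedBall _ _).inter_right hX

/-! ### The loop as a contracting system -/

namespace Population

variable {N : ℕ} {Sig : Set ℝ} {S : Population N Sig} {K : LinearController} {F : LinearFilter}
  {r : ℝ}

instance : Nonempty (S.LoopState K F) := by
  have h1 : ∀ i, Nonempty (S.X i) := fun i => (S.nonempty_X i).to_subtype
  have h2 : Nonempty F.X := F.nonempty_X.to_subtype
  have h3 : Nonempty K.X := K.nonempty_X.to_subtype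
  infer_instance

instance : ProperSpace (S.LoopState K F) := by
  have h1 : ∀ i, ProperSpace (S.X i) := fun i => (S.isClosed_X i).properSpace_subtype
  have h2 : ProperSpace F.X := F.isClosed_X.properSpace_subtype
  have h3 : ProperSpace K.X := K.isClosed_X.properSpace_subtype
  infer_instance

theorem p_le_one (S : Population N Sig) (i : Fin N) (j : Fin (S.w i)) (π : Sig) :
    S.p i j π ≤ 1 := by
  rw [← S.p_sum i π]
  exact Finset.single_le_sum (f := fun j => S.p i j π) (fun j _ => S.p_nonneg i j π)
    (Finset.mem_univ j)

theorem p'_le_one (S : Population N Sig) (i : Fin N) (j : Fin (S.h i)) (π : Sig) :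
    S.p' i j π ≤ 1 := by
  rw [← S.p'_sum i π]
  exact Finset.single_le_sum (f := fun j => S.p' i j π) (fun j _ => S.p'_nonneg i j π)
    (Finset.mem_univ j)

theorem abs_p_sub_le_one (S : Population N Sig) (i : Fin N) (j : Fin (S.w i)) (π π' : Sig) :
    |S.p i j π - S.p i j π'| ≤ 1 := by
  have h1 := S.p_le_one i j π
  have h2 := S.p_le_one i j π'
  exact abs_sub_le_iff.2 ⟨by linarith [S.p_nonneg i j π'], by linarith [S.p_nonneg i j π]⟩

theorem abs_p'_sub_le_one (S : Population N Sig) (i : Fin N) (j : Fin (S.h i)) (π π' : Sig) :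
    |S.p' i j π - S.p' i j π'| ≤ 1 := by
  have h1 := S.p'_le_one i j π
  have h2 := S.p'_le_one i j π'
  exact abs_sub_le_iff.2 ⟨by linarith [S.p'_nonneg i j π'], by linarith [S.p'_nonneg i j π]⟩

theorem dist_signal_le (hc : S.Compatible K F r) (ξ η : S.LoopState K F) :
    dist (signal hc ξ) (signal hc η) ≤
      (∑ i, |K.C i|) * ‖(ξ.2.2 : Fin K.n → ℝ) - η.2.2‖ +
        |K.D| * ((∑ i, |F.C i|) * ‖(ξ.2.1 : Fin F.n → ℝ) - η.2.1‖) := by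
  refine (K.abs_out_sub_le _ _ _ _).trans (add_le_add le_rfl ?_)
  refine mul_le_mul_of_nonneg_left ?_ (abs_nonneg _)
  rw [sub_sub_sub_cancel_left, abs_sub_comm]
  exact F.abs_out_sub_le _ _

/-- A modulus of continuity of the probabilities of the loop as functions of the signal. -/
noncomputable def loopModulus (S : Population N Sig) (t : ℝ) : ℝ :=
  (∑ i, ∑ j, (continuityModulus (S.p i j) t).toReal) +
    ∑ i, ∑ j, (continuityModulus (S.p' i j) t).toReal

theorem loopModulus_nonneg (S : Population N Sig) (t : ℝ) : 0 ≤ S.loopModulus t := by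
  unfold loopModulus; positivity

theorem loopModulus_mono (S : Population N Sig) : Monotone S.loopModulus := by
  intro s t hst
  refine add_le_add (Finset.sum_le_sum fun i _ => Finset.sum_le_sum fun j _ => ?_)
    (Finset.sum_le_sum fun i _ => Finset.sum_le_sum fun j _ => ?_)
  · exact ENNReal.toReal_mono ((continuityModulus_le_one (S.abs_p_sub_le_one i j) t).trans_lt
      ENNReal.one_lt_top).ne (continuityModulus_mono _ hst)
  · exact ENNReal.toReal_mono ((continuityModulus_le_one (S.abs_p'_sub_le_one i j) t).trans_lt
      ENNReal.one_lt_top).ne (continuityModulus_mono _ hst)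

theorem summable_loopModulus (hp : ∀ i j, DiniContinuous (S.p i j))
    (hp' : ∀ i j, DiniContinuous (S.p' i j)) {c ρ : ℝ} (hc : 0 < c) (h0 : 0 < ρ) (h1 : ρ < 1) :
    Summable fun n : ℕ => S.loopModulus (c * ρ ^ n) :=
  (summable_sum fun i _ => summable_sum fun j _ =>
    (hp i j).summable_continuityModulus hc h0 h1).add
  (summable_sum fun i _ => summable_sum fun j _ =>
    (hp' i j).summable_continuityModulus hc h0 h1)

/-- Products of numbers in [0, 1] differ by at most the sum of the differences of the factors.
Summing the moduli over all choices, not only those in `m`, makes the bound uniform in `m`. -/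
theorem abs_loop_q_sub_le (hc : S.Compatible K F r) (m : S.LoopIndex) {ξ η : S.LoopState K F}
    {t : ℝ} (ht : dist (signal hc ξ) (signal hc η) ≤ t) :
    |(loopIFS hc).q m ξ - (loopIFS hc).q m η| ≤ S.loopModulus t := by
  have b1 : ∀ (ζ : S.LoopState K F) i,
      0 ≤ S.p i (m.1 i) (signal hc ζ) ∧ S.p i (m.1 i) (signal hc ζ) ≤ 1 :=
    fun ζ i => ⟨S.p_nonneg _ _ _, S.p_le_one _ _ _⟩
  have b2 : ∀ (ζ : S.LoopState K F) i,
      0 ≤ S.p' i (m.2 i) (signal hc ζ) ∧ S.p' i (m.2 i) (signal hc ζ) ≤ 1 :=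
    fun ζ i => ⟨S.p'_nonneg _ _ _, S.p'_le_one _ _ _⟩
  refine (abs_mul_sub_mul_le_of_mem_unitInterval
    ⟨Finset.prod_nonneg fun i _ => (b2 ξ i).1,
      Finset.prod_le_one (fun i _ => (b2 ξ i).1) fun i _ => (b2 ξ i).2⟩
    ⟨Finset.prod_nonneg fun i _ => (b1 η i).1,
      Finset.prod_le_one (fun i _ => (b1 η i).1) fun i _ => (b1 η i).2⟩).trans ?_
  refine add_le_add ((Finset.abs_prod_sub_prod_le _ (b1 ξ) (b1 η)).trans ?_)
    ((Finset.abs_prod_sub_prod_le _ (b2 ξ) (b2 η)).trans ?_)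
  · refine Finset.sum_le_sum fun i _ => ?_
    refine (abs_sub_le_continuityModulus (S.abs_p_sub_le_one i (m.1 i)) ht).trans ?_
    exact Finset.single_le_sum (f := fun j => (continuityModulus (S.p i j) t).toReal)
      (fun _ _ => ENNReal.toReal_nonneg) (Finset.mem_univ (m.1 i))
  · refine Finset.sum_le_sum fun i _ => ?_
    refine (abs_sub_le_continuityModulus (S.abs_p'_sub_le_one i (m.2 i)) ht).trans ?_
    exact Finset.single_le_sum (f := fun j => (continuityModulus (S.p' i j) t).toReal)
      (fun _ _ => ENNReal.toReal_nonneg) (Finset.mem_univ (m.2 i))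

/-- Weighted sums of the distances of the agents' states and of adapted norms for filter and
controller. -/
noncomputable def loopGauge (S : Population N Sig) (K : LinearController) (F : LinearFilter)
    (a b : ℝ) (qF : Seminorm ℝ (Fin F.n → ℝ)) (qK : Seminorm ℝ (Fin K.n → ℝ))
    (ξ η : S.LoopState K F) : ℝ :=
  a * ∑ i, dist (ξ.1 i) (η.1 i) + b * qF ((ξ.2.1 : Fin F.n → ℝ) - η.2.1) +
    qK ((ξ.2.2 : Fin K.n → ℝ) - η.2.2)

/-- Each loop map is block triangular in the order agents, filter, controller, with contracting
diagonal blocks. Large weights on the upstream blocks absorb the couplings: an upstream difference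
is costly enough to pay for its effect downstream. -/
theorem exists_contracting (hc : S.Compatible K F r)
    (l : (i : Fin N) → Fin (S.w i) → ℝ≥0) (l' : (i : Fin N) → Fin (S.h i) → ℝ≥0)
    (hW : ∀ i j, LipschitzWith (l i j) (S.W i j)) (hH : ∀ i j, LipschitzWith (l' i j) (S.H i j))
    (hp : ∀ i j, DiniContinuous (S.p i j)) (hp' : ∀ i j, DiniContinuous (S.p' i j))
    {δ δ' : ℝ} (hδ : 0 < δ) (hδ' : 0 < δ')
    (hpδ : ∀ i j π, δ ≤ S.p i j π) (hpδ' : ∀ i j π, δ' ≤ S.p' i j π)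
    (hl : ∀ i j, l i j < 1) (hK : IsSchur K.A) (hF : IsSchur F.A) :
    ∃ V C ρ d Φ, (loopIFS hc).Contracting V C ρ d Φ := by
  obtain ⟨ρF, CF, qF, hρF0, hρF1, hCF, hqF1, hqF2, hqF⟩ := hF.exists_seminorm
  obtain ⟨ρK, CK, qK, hρK0, hρK1, hCK, hqK1, hqK2, hqK⟩ := hK.exists_seminorm
  obtain ⟨lmax, hlmax1, hlmax⟩ : ∃ lmax : ℝ≥0, lmax < 1 ∧ ∀ i j, l i j ≤ lmax :=
    ⟨Finset.univ.sup fun p : (i : Fin N) × Fin (S.w i) => l p.1 p.2,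
      (Finset.sup_lt_iff (by simp)).2 fun p _ => hl p.1 p.2,
      fun i j => Finset.le_sup (f := fun p : (i : Fin N) × Fin (S.w i) => l p.1 p.2)
        (Finset.mem_univ ⟨i, j⟩)⟩
  obtain ⟨L, hL⟩ : ∃ L : ℝ≥0, ∀ i j, l' i j ≤ L :=
    ⟨Finset.univ.sup fun p : (i : Fin N) × Fin (S.h i) => l' p.1 p.2,
      fun i j => Finset.le_sup (f := fun p : (i : Fin N) × Fin (S.h i) => l' p.1 p.2)
        (Finset.mem_univ ⟨i, j⟩)⟩
  set ρ₀ : ℝ := max lmax (max ρF ρK) with hρ₀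
  have hρ₀1 : ρ₀ < 1 := max_lt (by exact_mod_cast hlmax1) (max_lt hρF1 hρK1)
  have hρ₀0 : 0 < ρ₀ := lt_max_of_lt_right (lt_max_of_lt_left hρF0)
  have hlρ : (lmax : ℝ) ≤ ρ₀ := le_max_left _ _
  have hFρ : ρF ≤ ρ₀ := (le_max_left _ _).trans (le_max_right _ _)
  have hKρ : ρK ≤ ρ₀ := (le_max_right _ _).trans (le_max_right _ _)
  set cF : ℝ := ∑ i, |F.C i| with hcF
  set cK : ℝ := ∑ i, |K.C i| with hcK
  have hcF0 : 0 ≤ cF := Finset.sum_nonneg fun _ _ => abs_nonneg _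
  have hcK0 : 0 ≤ cK := Finset.sum_nonneg fun _ _ => abs_nonneg _
  have hBF : 0 ≤ qF F.B := apply_nonneg _ _
  have hBK : 0 ≤ qK K.B := apply_nonneg _ _
  -- Half the gap left by the slowest block rate `ρ₀` is spent on the couplings. The weight `b` pays
  -- for filter to controller, then `a` for agents to filter; the summand 1 in each weight makes the
  -- gauge dominate the distance.
  set η : ℝ := (1 - ρ₀) / 2 with hη
  have hη0 : 0 < η := by rw [hη]; linarith
  set b : ℝ := 1 + cF * qK K.B / η with hb
  have hb1 : 1 ≤ b := by rw [hb]; linarith [show 0 ≤ cF * qK K.B / η by positivity]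
  have hbη : cF * qK K.B ≤ b * η := by
    rw [hb, add_mul 1 _ η, div_mul_cancel₀ _ hη0.ne']; linarith
  set a : ℝ := 1 + b * (L * qF F.B) / η with ha
  have ha1 : 1 ≤ a := by rw [ha]; linarith [show 0 ≤ b * (L * qF F.B) / η by positivity]
  have haη : b * (L * qF F.B) ≤ a * η := by
    rw [ha, add_mul 1 _ η, div_mul_cancel₀ _ hη0.ne']; linarith
  have hX0 : ∀ ξ ζ : S.LoopState K F, 0 ≤ ∑ i, dist (ξ.1 i) (ζ.1 i) := fun ξ ζ =>
    Finset.sum_nonneg fun _ _ => dist_nonneg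
  have hF0 : ∀ x, 0 ≤ qF x := fun x => apply_nonneg _ _
  have hK0 : ∀ x, 0 ≤ qK x := fun x => apply_nonneg _ _
  have hVX : ∀ ξ ζ : S.LoopState K F,
      ∑ i, dist (ξ.1 i) (ζ.1 i) ≤ loopGauge S K F a b qF qK ξ ζ := fun ξ ζ => by
    unfold loopGauge
    nlinarith [hX0 ξ ζ, hF0 ((ξ.2.1 : Fin F.n → ℝ) - ζ.2.1), hK0 ((ξ.2.2 : Fin K.n → ℝ) - ζ.2.2)]
  have hVF : ∀ ξ ζ : S.LoopState K F,
      qF ((ξ.2.1 : Fin F.n → ℝ) - ζ.2.1) ≤ loopGauge S K F a b qF qK ξ ζ := fun ξ ζ => by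
    unfold loopGauge
    nlinarith [hX0 ξ ζ, hF0 ((ξ.2.1 : Fin F.n → ℝ) - ζ.2.1), hK0 ((ξ.2.2 : Fin K.n → ℝ) - ζ.2.2)]
  have hVK : ∀ ξ ζ : S.LoopState K F,
      qK ((ξ.2.2 : Fin K.n → ℝ) - ζ.2.2) ≤ loopGauge S K F a b qF qK ξ ζ := fun ξ ζ => by
    unfold loopGauge
    nlinarith [hX0 ξ ζ, hF0 ((ξ.2.1 : Fin F.n → ℝ) - ζ.2.1), hK0 ((ξ.2.2 : Fin K.n → ℝ) - ζ.2.2)]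
  have hdF : ∀ ξ ζ : S.LoopState K F,
      ‖(ξ.2.1 : Fin F.n → ℝ) - ζ.2.1‖ ≤ dist ξ ζ := fun ξ ζ => by
    rw [← dist_eq_norm]
    exact (le_max_left _ _).trans (le_max_right _ _)
  have hdK : ∀ ξ ζ : S.LoopState K F,
      ‖(ξ.2.2 : Fin K.n → ℝ) - ζ.2.2‖ ≤ dist ξ ζ := fun ξ ζ => by
    rw [← dist_eq_norm]
    exact (le_max_right _ _).trans (le_max_right _ _)
  -- A Lipschitz constant of the signal for the gauge; the summand 1 makes it positive, as the
  -- rescaled Dini sums require.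
  set c : ℝ := cK + |K.D| * cF + 1 with hcdef
  have hc0 : 0 < c := by positivity
  refine ⟨loopGauge S K F a b qF qK, a * N + b * CF + CK, ρ₀ + η,
    (∏ _i : Fin N, δ) * ∏ _i : Fin N, δ', fun t => S.loopModulus (c * t), ?_⟩
  constructor
  case symm =>
    intro ξ ζ
    unfold loopGauge
    rw [map_sub_rev qF, map_sub_rev qK]
    simp only [dist_comm]
  case triangle =>
    intro ξ ζ θ
    have t1 : ∑ i, dist (ξ.1 i) (θ.1 i) ≤
        ∑ i, dist (ξ.1 i) (ζ.1 i) + ∑ i, dist (ζ.1 i) (θ.1 i) := by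
      rw [← Finset.sum_add_distrib]
      exact Finset.sum_le_sum fun i _ => dist_triangle _ _ _
    have t2 := map_add_le_add qF ((ξ.2.1 : Fin F.n → ℝ) - ζ.2.1) (ζ.2.1 - θ.2.1)
    have t3 := map_add_le_add qK ((ξ.2.2 : Fin K.n → ℝ) - ζ.2.2) (ζ.2.2 - θ.2.2)
    rw [sub_add_sub_cancel] at t2 t3
    have t4 := mul_le_mul_of_nonneg_left t1 (zero_le_one.trans ha1)
    have t5 := mul_le_mul_of_nonneg_left t2 (zero_le_one.trans hb1)
    unfold loopGauge
    linarith
  case dist_le =>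
    intro ξ ζ
    refine max_le ?_ (max_le ?_ ?_)
    · refine (dist_pi_le_iff ((hX0 ξ ζ).trans (hVX ξ ζ))).2 fun i => le_trans ?_ (hVX ξ ζ)
      exact Finset.single_le_sum (f := fun i => dist (ξ.1 i) (ζ.1 i)) (fun _ _ => dist_nonneg)
        (Finset.mem_univ i)
    · refine le_trans ?_ (hVF ξ ζ)
      rw [Subtype.dist_eq, dist_eq_norm]
      exact hqF1 _
    · refine le_trans ?_ (hVK ξ ζ)
      rw [Subtype.dist_eq, dist_eq_norm]
      exact hqK1 _
  case le_dist =>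
    intro ξ ζ
    have t1 : ∑ i, dist (ξ.1 i) (ζ.1 i) ≤ N * dist ξ ζ := by
      have t0 : ∀ i, dist (ξ.1 i) (ζ.1 i) ≤ dist ξ ζ := fun i =>
        (dist_le_pi_dist ξ.1 ζ.1 i).trans (le_max_left _ _)
      simpa using Finset.sum_le_card_nsmul Finset.univ _ _ fun i _ => t0 i
    have t2 := (hqF2 ((ξ.2.1 : Fin F.n → ℝ) - ζ.2.1)).trans
      (mul_le_mul_of_nonneg_left (hdF ξ ζ) hCF)
    have t3 := (hqK2 ((ξ.2.2 : Fin K.n → ℝ) - ζ.2.2)).trans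
      (mul_le_mul_of_nonneg_left (hdK ξ ζ) hCK)
    have t4 := mul_le_mul_of_nonneg_left t1 (zero_le_one.trans ha1)
    have t5 := mul_le_mul_of_nonneg_left t2 (zero_le_one.trans hb1)
    unfold loopGauge
    linarith
  case C_nonneg => positivity
  case ρ_pos => positivity
  case ρ_lt => rw [hη]; linarith
  case contr =>
    intro m ξ ζ
    set x := ∑ i, dist (ξ.1 i) (ζ.1 i) with hx
    set u := qF ((ξ.2.1 : Fin F.n → ℝ) - ζ.2.1) with hu
    set v := qK ((ξ.2.2 : Fin K.n → ℝ) - ζ.2.2) with hv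
    have hx0 : 0 ≤ x := hX0 ξ ζ
    have hu0 : 0 ≤ u := hF0 _
    have hv0 : 0 ≤ v := hK0 _
    have t1 : ∑ i, dist (S.W i (m.1 i) (ξ.1 i)) (S.W i (m.1 i) (ζ.1 i)) ≤ ρ₀ * x := by
      rw [hx, Finset.mul_sum]
      refine Finset.sum_le_sum fun i _ => ((hW i (m.1 i)).dist_le_mul _ _).trans ?_
      refine mul_le_mul_of_nonneg_right (le_trans ?_ hlρ) dist_nonneg
      exact_mod_cast hlmax i (m.1 i)
    have ty : |∑ i, S.H i (m.2 i) (ξ.1 i) - ∑ i, S.H i (m.2 i) (ζ.1 i)| ≤ L * x := by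
      rw [← Finset.sum_sub_distrib, hx, Finset.mul_sum]
      refine (Finset.abs_sum_le_sum_abs _ _).trans (Finset.sum_le_sum fun i _ => ?_)
      refine ((hH i (m.2 i)).dist_le_mul _ _).trans ?_
      refine mul_le_mul_of_nonneg_right ?_ dist_nonneg
      exact_mod_cast hL i (m.2 i)
    have t2 : qF (F.next ξ.2.1 (∑ i, S.H i (m.2 i) (ξ.1 i)) -
        F.next ζ.2.1 (∑ i, S.H i (m.2 i) (ζ.1 i))) ≤ ρ₀ * u + L * x * qF F.B := by
      rw [F.next_sub_next]
      refine (map_add_le_add qF _ _).trans (add_le_add ?_ ?_)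
      · exact (hqF _).trans (mul_le_mul_of_nonneg_right hFρ hu0)
      · rw [map_smul_eq_mul, Real.norm_eq_abs]
        exact mul_le_mul_of_nonneg_right ty hBF
    have te : |(r - F.out ξ.2.1) - (r - F.out ζ.2.1)| ≤ cF * u := by
      rw [sub_sub_sub_cancel_left, abs_sub_comm]
      exact (F.abs_out_sub_le _ _).trans (mul_le_mul_of_nonneg_left (hqF1 _) hcF0)
    have t3 : qK (K.next ξ.2.2 (r - F.out ξ.2.1) - K.next ζ.2.2 (r - F.out ζ.2.1)) ≤
        ρ₀ * v + cF * u * qK K.B := by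
      rw [K.next_sub_next]
      refine (map_add_le_add qK _ _).trans (add_le_add ?_ ?_)
      · exact (hqK _).trans (mul_le_mul_of_nonneg_right hKρ hv0)
      · rw [map_smul_eq_mul, Real.norm_eq_abs]
        exact mul_le_mul_of_nonneg_right te hBK
    change a * ∑ i, dist (S.W i (m.1 i) (ξ.1 i)) (S.W i (m.1 i) (ζ.1 i)) +
      b * qF (F.next ξ.2.1 (∑ i, S.H i (m.2 i) (ξ.1 i)) -
        F.next ζ.2.1 (∑ i, S.H i (m.2 i) (ζ.1 i))) +
      qK (K.next ξ.2.2 (r - F.out ξ.2.1) - K.next ζ.2.2 (r - F.out ζ.2.1)) ≤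
        (ρ₀ + η) * (a * x + b * u + v)
    have t4 := mul_le_mul_of_nonneg_left t1 (zero_le_one.trans ha1)
    have t5 := mul_le_mul_of_nonneg_left t2 (zero_le_one.trans hb1)
    have t6 := mul_le_mul_of_nonneg_right haη hx0
    have t7 := mul_le_mul_of_nonneg_right hbη hu0
    have t8 := mul_nonneg hη0.le hv0
    linarith
  case d_pos => positivity
  case d_le =>
    intro m ξ
    exact mul_le_mul (Finset.prod_le_prod (fun _ _ => hδ.le) fun i _ => hpδ _ _ _)
      (Finset.prod_le_prod (fun _ _ => hδ'.le) fun i _ => hpδ' _ _ _)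
      (Finset.prod_nonneg fun _ _ => hδ'.le) (Finset.prod_nonneg fun i _ => S.p_nonneg _ _ _)
  case osc =>
    intro m ξ ζ t ht
    refine abs_loop_q_sub_le hc m ((dist_signal_le hc ξ ζ).trans ?_)
    have hV0 := (hK0 _).trans (hVK ξ ζ)
    have s1 := mul_le_mul_of_nonneg_left ((hqK1 _).trans (hVK ξ ζ)) hcK0
    have s2 := mul_le_mul_of_nonneg_left ((hqF1 _).trans (hVF ξ ζ))
      (mul_nonneg (abs_nonneg K.D) hcF0)
    have s3 := mul_le_mul_of_nonneg_left ht hc0.le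
    have s4 : c * loopGauge S K F a b qF qK ξ ζ = cK * loopGauge S K F a b qF qK ξ ζ +
        |K.D| * cF * loopGauge S K F a b qF qK ξ ζ + loopGauge S K F a b qF qK ξ ζ := by
      rw [hcdef]; ring
    rw [← mul_assoc]
    linarith
  case Φ_mono => exact fun s t hst => S.loopModulus_mono (mul_le_mul_of_nonneg_left hst hc0.le)
  case Φ_nonneg => exact fun t => S.loopModulus_nonneg _
  case Φ_summable =>
    intro D hD
    simp only [← mul_assoc]
    exact summable_loopModulus hp hp' (mul_pos hc0 hD) (by positivity) (by rw [hη]; linarith)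

end Population

theorem theorem6 (N : ℕ) (Sig : Set ℝ) (S : Population N Sig)
    (l : (i : Fin N) → Fin (S.w i) → ℝ≥0) (l' : (i : Fin N) → Fin (S.h i) → ℝ≥0)
    (hW : ∀ i j, LipschitzWith (l i j) (S.W i j))
    (hH : ∀ i j, LipschitzWith (l' i j) (S.H i j))
    (hp : ∀ i j, DiniContinuous (S.p i j))
    (hp' : ∀ i j, DiniContinuous (S.p' i j))
    (δ δ' : ℝ) (hδ : 0 < δ) (hδ' : 0 < δ')
    (hpδ : ∀ i j π, δ ≤ S.p i j π)
    (hpδ' : ∀ i j π, δ' ≤ S.p' i j π)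
    (hl : ∀ i j, l i j < 1)
    (r : ℝ) (K : LinearController) (F : LinearFilter)
    (hK : IsSchur K.A) (hF : IsSchur F.A) (hc : S.Compatible K F r) :
    MarkovChain.HasUniqueAttractiveInvariantMeasure (Population.loopIFS hc).kernel ∧
      MarkovChain.UniquelyErgodic (Population.loopIFS hc).kernel := by
  obtain ⟨V, C, ρ, d, Φ, h⟩ :=
    Population.exists_contracting hc l l' hW hH hp hp' hδ hδ' hpδ hpδ' hl hK hF
  exact ⟨h.uniquelyErgodic.hasUniqueAttractiveInvariantMeasure, h.uniquelyErgodic⟩
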